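/- Let $M$ be a $C^\infty$ manifold of dimension $m\ge 3$ with a $C^\infty$ torsion free affine connection $\nabla$, and let $q\in M$. Suppose that $(M,\nabla)$ is locally projectively flat around $q$, i.e. there is a diffeomorphism $\Phi$ from a neighbourhood $U$ of $q$ onto an open subset of $\mathbf R^m$ which maps the $\nabla$-geodesics in $U$, up to parametrization, to straight lines. For a $C^\infty$ curve $\gamma$ in $M$ put $\nabla\gamma=\gamma'$ and $\nabla^{k}\gamma=\nabla^{\gamma}_{\partial/\partial t}(\nabla^{k-1}\gamma)$ for $k\ge2$, where $\nabla^{\gamma}_{\partial/\partial t}$ is the covariant derivative along $\gamma$. Let $\gamma$ be a $C^\infty$ curve defined near $t_0\in\mathbf R$ with $\gamma(t_0)=q$ which is torsionless: for every $t$ near $t_0$ the vectors $(\nabla\gamma)(t),(\nabla^2\gamma)(t)$ are linearly independent and $(\nabla\gamma)(t),(\nabla^2\gamma)(t),(\nabla^3\gamma)(t)$ are linearly dependent. Let $f=\nabla\text{-Tan}(\gamma)$ be the $\nabla$-tangent surface of $\gamma$, i.e. $f(t,s)=\varphi(\gamma(t),\gamma'(t),s)$, where $s\mapsto\varphi(x,v,s)$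 is the $\nabla$-geodesic with $\varphi(x,v,0)=x$ and $\frac{\partial\varphi}{\partial s}(x,v,0)=v$. Then $f(t_0,0)=q$, and the germ $f:(\mathbf R^2,(t_0,0))\to(M,q)$ is a fold: it is $C^\infty$, and there are diffeomorphism germs $\sigma:(\mathbf R^2,(t_0,0))\to(\mathbf R^2,0)$ and $\tau:(M,q)\to(\mathbf R^m,0)$ such that $\tau\circ f=g\circ\sigma$ for $g(t,s)=(t+s,\;t^2+2st,\;0,\dots,0)$. In particular $f$ is generically two-to-one near $(t_0,0)$: every neighbourhood of $(t_0,0)$ contains an open neighbourhood $W$ of $(t_0,0)$ and an open dense subset $O$ of $W$ such that for every $z\in O$ there are exactly two points $w\in W$ with $f(w)=f(z)$. -/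

import Mathlib

open Set Filter Topology
open scoped Manifold ContDiff

noncomputable section

section AffineConnection

variable {m : ℕ} {M : Type*} [TopologicalSpace M] [ChartedSpace (EuclideanSpace ℝ (Fin m)) M]

/-- The velocity vector `γ'(t) ∈ T_{γ(t)} M` of a curve. -/
def curveVelocity (γ : ℝ → M) (t : ℝ) : TangentSpace (𝓡 m) (γ t) :=
  mfderiv 𝓘(ℝ, ℝ) (𝓡 m) γ t (1 : ℝ)

variable [IsManifold (𝓡 m) ∞ M]

/-- The covariant derivative `∇_{∂/∂t} v` of a vector field `v` along a curve `γ`.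
Let `∂_ν` be the coordinate frame of the preferred chart at `γ t`, let `v^ν` be the components of
`v` in it and let `c = v t`. The first summand is `(dv^ν/dt) ∂_ν`. The field `extend (v t)` is the
field `c^ν ∂_ν` with constant components, so the second summand is
`c^ν ∇_{γ'} ∂_ν = Γ^λ_{μν} (γ')^μ v^ν ∂_λ`. -/
def covDerivAlong
    (cov : CovariantDerivative (𝓡 m) (EuclideanSpace ℝ (Fin m)) (TangentSpace (𝓡 m) : M → Type _))
    (γ : ℝ → M) (v : ∀ t : ℝ, TangentSpace (𝓡 m) (γ t)) (t : ℝ) : TangentSpace (𝓡 m) (γ t) :=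
  (trivializationAt (EuclideanSpace ℝ (Fin m)) (TangentSpace (𝓡 m) : M → Type _) (γ t)).symm (γ t)
      (deriv (fun τ : ℝ =>
        (trivializationAt (EuclideanSpace ℝ (Fin m)) (TangentSpace (𝓡 m) : M → Type _) (γ t)
          ⟨γ τ, v τ⟩).2) t)
    + cov (FiberBundle.extend (EuclideanSpace ℝ (Fin m)) (v t)) (γ t) (curveVelocity γ t)

/-- The iterated covariant derivatives of a curve: `iterCovDeriv cov γ k` is `∇^{k+1} γ`, that is,
`γ'` for `k = 0`, `∇_{∂/∂t} γ'` for `k = 1`, and so on. -/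
def iterCovDeriv
    (cov : CovariantDerivative (𝓡 m) (EuclideanSpace ℝ (Fin m)) (TangentSpace (𝓡 m) : M → Type _))
    (γ : ℝ → M) : ℕ → ∀ t : ℝ, TangentSpace (𝓡 m) (γ t)
  | 0 => curveVelocity γ
  | k + 1 => covDerivAlong cov γ (iterCovDeriv cov γ k)

/-- `γ` is a smooth torsionless curve on `J`: at every `t ∈ J` the vectors `∇γ, ∇²γ` are linearly
independent and `∇γ, ∇²γ, ∇³γ` are linearly dependent. -/
structure IsTorsionlessOn
    (cov : CovariantDerivative (𝓡 m) (EuclideanSpace ℝ (Fin m)) (TangentSpace (𝓡 m) : M → Type _))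
    (γ : ℝ → M) (J : Set ℝ) : Prop where
  smooth : ContMDiffOn 𝓘(ℝ, ℝ) (𝓡 m) ∞ γ J
  indep : ∀ t ∈ J,
    LinearIndependent ℝ ![iterCovDeriv cov γ 0 t, iterCovDeriv cov γ 1 t]
  dep : ∀ t ∈ J,
    ¬ LinearIndependent ℝ
      ![iterCovDeriv cov γ 0 t, iterCovDeriv cov γ 1 t, iterCovDeriv cov γ 2 t]

/-- `c` is a `∇`-geodesic on `J`: it is smooth and `∇_{∂/∂s} c' = 0` on `J`. -/
structure IsGeodesicCurveOn
    (cov : CovariantDerivative (𝓡 m) (EuclideanSpace ℝ (Fin m)) (TangentSpace (𝓡 m) : M → Type _))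
    (c : ℝ → M) (J : Set ℝ) : Prop where
  smooth : ContMDiffOn 𝓘(ℝ, ℝ) (𝓡 m) ∞ c J
  geodesic : ∀ s ∈ J, covDerivAlong cov c (curveVelocity c) s = 0

/-- `c` is a `∇`-geodesic on the open interval `J`, which contains `0`, with initial point and
initial velocity given by the tangent vector `p = (x, v)`. -/
structure IsGeodesicFrom
    (cov : CovariantDerivative (𝓡 m) (EuclideanSpace ℝ (Fin m)) (TangentSpace (𝓡 m) : M → Type _))
    (p : TangentBundle (𝓡 m) M) (c : ℝ → M) (J : Set ℝ) : Prop where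
  isOpen : IsOpen J
  ordConnected : J.OrdConnected
  zero_mem : (0 : ℝ) ∈ J
  isGeodesic : IsGeodesicCurveOn cov c J
  initial : (⟨c 0, curveVelocity c 0⟩ : TangentBundle (𝓡 m) M) = p

open Classical in
/-- The geodesic map `φ(x, v, s)`, `p = (x, v)`: the value at time `s` of the `∇`-geodesic with
initial point `x` and initial velocity `v`. Where that geodesic is not defined up to time `s` the
value is `x`, by convention. -/
def geodesicMap
    (cov : CovariantDerivative (𝓡 m) (EuclideanSpace ℝ (Fin m)) (TangentSpace (𝓡 m) : M → Type _))
    (p : TangentBundle (𝓡 m) M) (s : ℝ) : M :=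
  if h : ∃ c : ℝ → M, ∃ J : Set ℝ, IsGeodesicFrom cov p c J ∧ s ∈ J then h.choose s else p.proj

/-- The `∇`-tangent surface `(t, s) ↦ φ(γ(t), γ'(t), s)` of a curve. -/
def tangentSurface
    (cov : CovariantDerivative (𝓡 m) (EuclideanSpace ℝ (Fin m)) (TangentSpace (𝓡 m) : M → Type _))
    (γ : ℝ → M) (z : ℝ × ℝ) : M :=
  geodesicMap cov ⟨γ z.1, curveVelocity γ z.1⟩ z.2

/-- `∇` is locally projectively flat around `q`: a diffeomorphism from a neighbourhood of `q` to an
open subset of Euclidean space is a projective equivalence onto its image with the standard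
connection, that is, it maps the `∇`-geodesics to straight lines up to parametrization. -/
def IsProjectivelyFlatAround
    (cov : CovariantDerivative (𝓡 m) (EuclideanSpace ℝ (Fin m)) (TangentSpace (𝓡 m) : M → Type _))
    (q : M) : Prop :=
  ∃ Φ : M → EuclideanSpace ℝ (Fin m),
    IsLocalDiffeomorphAt (𝓡 m) 𝓘(ℝ, EuclideanSpace ℝ (Fin m)) ∞ Φ q ∧
    ∃ U ∈ 𝓝 q, ∀ (c : ℝ → M) (J : Set ℝ), IsOpen J → J.OrdConnected →
      IsGeodesicCurveOn cov c J → MapsTo c J U →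
      ∃ a b : EuclideanSpace ℝ (Fin m), ∀ s ∈ J, ∃ r : ℝ, Φ (c s) = a + r • b

end AffineConnection

section Fold

/-- The model `(t, s) ↦ (t + s, t² + 2st, 0, …, 0)` of the (embedded) fold. -/
def foldModel (m : ℕ) (z : ℝ × ℝ) : EuclideanSpace ℝ (Fin m) :=
  WithLp.toLp 2 fun i : Fin m =>
    if (i : ℕ) = 0 then z.1 + z.2
    else if (i : ℕ) = 1 then z.1 ^ 2 + 2 * z.2 * z.1
    else 0

/-- The germ of `f` at `p` is a fold: it is smooth, and `τ ∘ f = foldModel ∘ σ` near `p` for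
diffeomorphism germs `σ : (ℝ², p) → (ℝ², 0)` and `τ : (M, f p) → (ℝᵐ, 0)`. -/
def IsFoldAt (m : ℕ) {M : Type*} [TopologicalSpace M]
    [ChartedSpace (EuclideanSpace ℝ (Fin m)) M] (f : ℝ × ℝ → M) (p : ℝ × ℝ) : Prop :=
  (∀ᶠ z in 𝓝 p, ContMDiffAt 𝓘(ℝ, ℝ × ℝ) (𝓡 m) ∞ f z) ∧
  ∃ (σ : ℝ × ℝ → ℝ × ℝ) (τ : M → EuclideanSpace ℝ (Fin m)),
    IsLocalDiffeomorphAt 𝓘(ℝ, ℝ × ℝ) 𝓘(ℝ, ℝ × ℝ) ∞ σ p ∧ σ p = 0 ∧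
    IsLocalDiffeomorphAt (𝓡 m) 𝓘(ℝ, EuclideanSpace ℝ (Fin m)) ∞ τ (f p) ∧ τ (f p) = 0 ∧
    ∀ᶠ z in 𝓝 p, τ (f z) = foldModel m (σ z)

/-- The germ of `f` at `p` is generically two-to-one: there are arbitrarily small open
neighbourhoods `W` of `p` such that, for all `z` in an open dense subset of `W`, the fibre of `f|_W`
through `z` has exactly two points. -/
def IsGenericallyTwoToOneAt {X Y : Type*} [TopologicalSpace X] (f : X → Y) (p : X) : Prop :=
  ∀ N ∈ 𝓝 p, ∃ W ⊆ N, IsOpen W ∧ p ∈ W ∧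
    ∃ O ⊆ W, IsOpen O ∧ W ⊆ closure O ∧ ∀ z ∈ O, {w ∈ W | f w = f z}.ncard = 2

end Fold

end

/-! Work in coordinates `Ψ` in which geodesics lie on straight lines. A geodesic with velocity `v`
then has acceleration `-Γ(v, v)` parallel to `v`, so `Γ(v, v)` is always a multiple of `v`. Since
the torsion vanishes, `Γ` is symmetric, and polarization puts `Γ(u, w)` in the span of `u` and `w`
(`exists_christoffelForm_eq_add`).

This has two consequences for `g = Ψ ∘ γ`. The covariant derivatives of `γ` differ from the ordinary
derivatives of `g` only by combinations of lower ones, so `g'`, `g''` are independent and `g'''`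
lies in their span (`linearIndependent_deriv_of_torsionless`). Thus `g` is a plane curve of nonzero
curvature. Moreover the geodesic issuing from `γ'(t)` is the tangent line `g + r(t, s) g'`, where
`r` solves the scalar equation `r'' = -κ(t, r) (r')²`. That equation is solved by two quadratures
and an inversion, which makes `r` jointly smooth (`exists_affine_reparametrization`,
`exists_tangentSurface_eq`).

It remains to treat the tangent lines of a planar graph `y = h(x)` with `h''(0) = 1`. The point at
horizontal distance `R` from the point of contact `T` is `(T + R, h(T) + R h'(T))`. By Taylor's
formula its height is `h(T + R) - R² k(T, R)` with `k(0, 0) = 1/2`. Put `b = R √k` and `a = T + R -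
b`. Adding `X² - h(X)` to the height over `X = a + b` turns it into `X² - b² = a² + 2ab`, which is
the model (`exists_fold_normal_form`). The model is `(t + s, (t + s)² - s²)` in its first two
coordinates, so its fibres are exchanged by `s ↦ -s` with `t + s` fixed; this gives two-to-oneness.
-/

noncomputable section

/-! ### Coordinate frames of a local diffeomorphism to Euclidean space. -/

section Frame

open VectorField

variable {m : ℕ} {M : Type*} [TopologicalSpace M] [ChartedSpace (EuclideanSpace ℝ (Fin m)) M]

local notation "𝔼" => EuclideanSpace ℝ (Fin m)

namespace PartialDiffeomorph

lemma contMDiffAt (Ψ : PartialDiffeomorph (𝓡 m) 𝓘(ℝ, 𝔼) M 𝔼 ∞) {x : M} (hx : x ∈ Ψ.source) :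
    ContMDiffAt (𝓡 m) 𝓘(ℝ, 𝔼) ∞ Ψ x :=
  (Ψ.contMDiffOn x hx).contMDiffAt (Ψ.open_source.mem_nhds hx)

lemma isInvertible_mfderiv (Ψ : PartialDiffeomorph (𝓡 m) 𝓘(ℝ, 𝔼) M 𝔼 ∞) {x : M}
    (hx : x ∈ Ψ.source) : (mfderiv (𝓡 m) 𝓘(ℝ, 𝔼) Ψ x).IsInvertible :=
  ⟨(Ψ.isLocalDiffeomorphAt (n := ∞) (𝓡 m) 𝓘(ℝ, 𝔼) hx).mfderivToContinuousLinearEquiv (by simp), rfl⟩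

/-- The differential of `Ψ` at `x`, as a linear map to Euclidean space. -/
def dcoord (Ψ : PartialDiffeomorph (𝓡 m) 𝓘(ℝ, 𝔼) M 𝔼 ∞) (x : M) :
    TangentSpace (𝓡 m) x →L[ℝ] 𝔼 :=
  mfderiv (𝓡 m) 𝓘(ℝ, 𝔼) Ψ x

lemma dcoord_injective (Ψ : PartialDiffeomorph (𝓡 m) 𝓘(ℝ, 𝔼) M 𝔼 ∞) {x : M}
    (hx : x ∈ Ψ.source) : Function.Injective (Ψ.dcoord x) :=
  (Ψ.isInvertible_mfderiv hx).injective

/-- The coordinate frame of a local diffeomorphism to Euclidean space. -/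
def coordFrame (Ψ : PartialDiffeomorph (𝓡 m) 𝓘(ℝ, 𝔼) M 𝔼 ∞) (i : Fin m) :
    ∀ x : M, TangentSpace (𝓡 m) x :=
  mpullback (𝓡 m) 𝓘(ℝ, 𝔼) Ψ (fun _ => (EuclideanSpace.single i (1 : ℝ) : 𝔼))

lemma dcoord_coordFrame (Ψ : PartialDiffeomorph (𝓡 m) 𝓘(ℝ, 𝔼) M 𝔼 ∞) {x : M}
    (hx : x ∈ Ψ.source) (i : Fin m) :
    Ψ.dcoord x (Ψ.coordFrame i x) = EuclideanSpace.single i (1 : ℝ) :=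
  (Ψ.isInvertible_mfderiv hx).self_apply_inverse _

lemma eq_sum_coordFrame (Ψ : PartialDiffeomorph (𝓡 m) 𝓘(ℝ, 𝔼) M 𝔼 ∞) {x : M}
    (hx : x ∈ Ψ.source) (v : TangentSpace (𝓡 m) x) :
    v = ∑ i, Ψ.dcoord x v i • Ψ.coordFrame i x := by
  apply Ψ.dcoord_injective hx
  simp_rw [map_sum, map_smul, Ψ.dcoord_coordFrame hx]
  have := (EuclideanSpace.basisFun (Fin m) ℝ).sum_repr (Ψ.dcoord x v)
  simp at this
  exact this.symm

variable [IsManifold (𝓡 m) ∞ M]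

lemma contMDiffAt_coordFrame (Ψ : PartialDiffeomorph (𝓡 m) 𝓘(ℝ, 𝔼) M 𝔼 ∞) {x : M}
    (hx : x ∈ Ψ.source) (i : Fin m) :
    ContMDiffAt (𝓡 m) ((𝓡 m).prod 𝓘(ℝ, 𝔼)) ∞
      (fun x => (⟨x, Ψ.coordFrame i x⟩ : TangentBundle (𝓡 m) M)) x := by
  refine ContMDiffAt.mpullback_vectorField_preimage (n := ∞) ?_ (Ψ.contMDiffAt hx)
    (Ψ.isInvertible_mfderiv hx) (by simp)
  exact contMDiffAt_vectorSpace_iff_contDiffAt.2 contDiffAt_const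

lemma mdifferentiableAt_coordFrame (Ψ : PartialDiffeomorph (𝓡 m) 𝓘(ℝ, 𝔼) M 𝔼 ∞) {x : M}
    (hx : x ∈ Ψ.source) (i : Fin m) :
    MDifferentiableAt (𝓡 m) ((𝓡 m).prod 𝓘(ℝ, 𝔼))
      (fun x => (⟨x, Ψ.coordFrame i x⟩ : TangentBundle (𝓡 m) M)) x :=
  (Ψ.contMDiffAt_coordFrame hx i).mdifferentiableAt (by simp)

/-- Brackets commute with pullback, and constant fields commute. This turns vanishing torsion into
symmetry of the Christoffel symbols. -/
lemma mlieBracket_coordFrame (Ψ : PartialDiffeomorph (𝓡 m) 𝓘(ℝ, 𝔼) M 𝔼 ∞) {x : M}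
    (hx : x ∈ Ψ.source) (i j : Fin m) :
    mlieBracket (𝓡 m) (Ψ.coordFrame i) (Ψ.coordFrame j) x = 0 := by
  have hc : ∀ i : Fin m, MDifferentiableAt 𝓘(ℝ, 𝔼) (𝓘(ℝ, 𝔼).prod 𝓘(ℝ, 𝔼))
      (fun y : 𝔼 => (⟨y, (EuclideanSpace.single i (1 : ℝ) : 𝔼)⟩ : TangentBundle 𝓘(ℝ, 𝔼) 𝔼))
      (Ψ x) := by
    intro i
    refine ContMDiffAt.mdifferentiableAt (n := 1) ?_ (by simp)
    exact contMDiffAt_vectorSpace_iff_contDiffAt.2 contDiffAt_const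
  have : IsManifold (𝓡 m) (minSmoothness ℝ 3) M := by
    simp only [minSmoothness_of_isRCLikeNormedField]
    infer_instance
  have := mpullback_mlieBracket (I := 𝓡 m) (n := ∞) (hc i) (hc j) (Ψ.contMDiffAt hx)
    (by simp only [minSmoothness_of_isRCLikeNormedField];
        exact ENat.LEInfty.out)
  unfold coordFrame
  rw [← this]
  have h0 : mlieBracket 𝓘(ℝ, 𝔼) (fun y : 𝔼 => (EuclideanSpace.single i (1 : ℝ) : 𝔼))
     (fun y : 𝔼 => (EuclideanSpace.single j (1 : ℝ) : 𝔼)) (Ψ x) = 0 := by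
    refine (congrFun (mlieBracketWithin_univ (I := 𝓘(ℝ, 𝔼))).symm (Ψ x)).trans
      ((congrFun (mlieBracketWithin_eq_lieBracketWithin (𝕜 := ℝ) (E := 𝔼)) (Ψ x)).trans ?_)
    have h1 := fun i : Fin m =>
      fderivWithin_const_apply (𝕜 := ℝ) (s := univ) (x := Ψ x) (EuclideanSpace.single i (1 : ℝ) : 𝔼)
    unfold lieBracketWithin
    erw [h1, h1]
    simp
    rfl
  rw [mpullback_apply, h0, map_zero]

/-- In terms of the preferred trivialization at `x₀`, the differential of `Ψ` is given by a smooth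
family of linear maps near `x₀`. -/
lemma exists_contMDiffAt_mfderiv_eq (Ψ : PartialDiffeomorph (𝓡 m) 𝓘(ℝ, 𝔼) M 𝔼 ∞) {x₀ : M}
    (hx₀ : x₀ ∈ Ψ.source) :
    ∃ A : M → 𝔼 →L[ℝ] 𝔼, ContMDiffAt (𝓡 m) 𝓘(ℝ, 𝔼 →L[ℝ] 𝔼) ∞ A x₀ ∧
      ∀ᶠ x in 𝓝 x₀, ∀ v : TangentSpace (𝓡 m) x, Ψ.dcoord x v =
        A x (trivializationAt 𝔼 (TangentSpace (𝓡 m) : M → Type _) x₀ ⟨x, v⟩).2 := by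
  refine ⟨_, (Ψ.contMDiffAt hx₀).mfderiv_const (m := ∞) (by simp), ?_⟩
  have hb := (trivializationAt 𝔼 (TangentSpace (𝓡 m) : M → Type _) x₀).open_baseSet.mem_nhds
    (FiberBundle.mem_baseSet_trivializationAt' x₀)
  filter_upwards [hb] with x hx v
  have hv := (trivializationAt 𝔼 (TangentSpace (𝓡 m) : M → Type _) x₀).symmL_continuousLinearMapAt
    (R := ℝ) hx v
  rw [Bundle.Trivialization.continuousLinearMapAt_apply_of_mem ℝ _ hx] at hv
  have h1 := fun w : 𝔼 => DFunLike.congr_fun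
    (TangentBundle.continuousLinearMapAt_model_space (𝕜 := ℝ) (Ψ x₀) (Ψ x)) w
  refine Eq.trans ?_ (h1 (mfderiv (𝓡 m) 𝓘(ℝ, 𝔼) Ψ x
    ((trivializationAt 𝔼 (TangentSpace (𝓡 m) : M → Type _) x₀).symmL ℝ x
    (trivializationAt 𝔼 (TangentSpace (𝓡 m) : M → Type _) x₀ ⟨x, v⟩).2))).symm
  rw [hv]
  rfl

end PartialDiffeomorph

end Frame

end

noncomputable section

/-! ### Christoffel symbols and covariant derivatives in coordinates. -/

section Christoffel

open VectorField

variable {m : ℕ} {M : Type*} [TopologicalSpace M] [ChartedSpace (EuclideanSpace ℝ (Fin m)) M]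

local notation "𝔼" => EuclideanSpace ℝ (Fin m)

/-- The bilinear expression `(u, w) ↦ G_{ij} u^i w^j`. -/
def christoffelForm (G : Fin m → Fin m → 𝔼 → 𝔼) (y u w : 𝔼) : 𝔼 :=
  ∑ i, ∑ j, (u i * w j) • G i j y

lemma PartialDiffeomorph.symm_apply_apply (Ψ : PartialDiffeomorph (𝓡 m) 𝓘(ℝ, 𝔼) M 𝔼 ∞) {x : M}
    (hx : x ∈ Ψ.source) : Ψ.symm (Ψ x) = x := Ψ.left_inv hx

variable [IsManifold (𝓡 m) ∞ M]

namespace PartialDiffeomorph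

/-- The Christoffel symbols `Γ_{ij}` of a connection in the coordinates `Ψ`. -/
def christoffel (Ψ : PartialDiffeomorph (𝓡 m) 𝓘(ℝ, 𝔼) M 𝔼 ∞)
    (cov : CovariantDerivative (𝓡 m) 𝔼 (TangentSpace (𝓡 m) : M → Type _)) (i j : Fin m) (y : 𝔼) :
    𝔼 :=
  Ψ.dcoord (Ψ.symm y) (cov (Ψ.coordFrame j) (Ψ.symm y) (Ψ.coordFrame i (Ψ.symm y)))

lemma christoffel_comm (Ψ : PartialDiffeomorph (𝓡 m) 𝓘(ℝ, 𝔼) M 𝔼 ∞)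
    (cov : CovariantDerivative (𝓡 m) 𝔼 (TangentSpace (𝓡 m) : M → Type _))
    (htorsion : cov.torsion = 0) (i j : Fin m) {y : 𝔼} (hy : y ∈ Ψ.target) :
    Ψ.christoffel cov i j y = Ψ.christoffel cov j i y := by
  have hx : Ψ.symm y ∈ Ψ.source := Ψ.map_target hy
  have := cov.torsion_eq_zero_iff.1 htorsion (Ψ.mdifferentiableAt_coordFrame hx i)
    (Ψ.mdifferentiableAt_coordFrame hx j)
  rw [Ψ.mlieBracket_coordFrame hx] at this
  unfold christoffel
  rw [sub_eq_zero.1 this]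

lemma _root_.CovariantDerivative.sum_smul_apply {ι : Type*}
    (cov : CovariantDerivative (𝓡 m) 𝔼 (TangentSpace (𝓡 m) : M → Type _)) (I : Finset ι)
    (s : ι → M → ℝ) (X : ι → ∀ x : M, TangentSpace (𝓡 m) x) (x : M)
    (hs : ∀ i, MDifferentiableAt (𝓡 m) 𝓘(ℝ, ℝ) (s i) x)
    (hX : ∀ i, MDifferentiableAt (𝓡 m) ((𝓡 m).prod 𝓘(ℝ, 𝔼))
      (fun x => (⟨x, X i x⟩ : TangentBundle (𝓡 m) M)) x) (u : TangentSpace (𝓡 m) x) :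
    cov (fun x => ∑ i ∈ I, s i x • X i x) x u =
      ∑ i ∈ I, (s i x • cov (X i) x u + (show ℝ from mfderiv (𝓡 m) 𝓘(ℝ, ℝ) (s i) x u) • X i x) := by
  classical
  induction I using Finset.induction_on with
  | empty =>
    simp only [Finset.sum_empty]
    exact DFunLike.congr_fun (congrFun cov.zero x) u
  | insert a I ha ih =>
    have h1 : (fun x => ∑ i ∈ insert a I, s i x • X i x) =
        (s a • X a) + fun x => ∑ i ∈ I, s i x • X i x := by
      funext x
      rw [Finset.sum_insert ha]
      rfl
    have h2 := cov.isCovariantDerivativeOnUniv.add (x := x) ((hs a).smul_section (hX a))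
      (MDifferentiableAt.sum_section (t := fun i => s i • X i) (s := I)
        fun i _ => (hs i).smul_section (hX i))
    rw [h1, Finset.sum_insert ha, ← ih]
    refine (DFunLike.congr_fun h2 u).trans ?_
    rw [add_apply, cov.isCovariantDerivativeOnUniv.leibniz (hX a) (hs a)]
    rfl

/-- The covariant derivative of a vector field in terms of its components in the coordinates `Ψ`. -/
lemma dcoord_cov (Ψ : PartialDiffeomorph (𝓡 m) 𝓘(ℝ, 𝔼) M 𝔼 ∞)
    (cov : CovariantDerivative (𝓡 m) 𝔼 (TangentSpace (𝓡 m) : M → Type _))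
    {x : M} (hx : x ∈ Ψ.source) (σ : ∀ x : M, TangentSpace (𝓡 m) x)
    (hσ : MDifferentiableAt (𝓡 m) ((𝓡 m).prod 𝓘(ℝ, 𝔼))
      (fun x => (⟨x, σ x⟩ : TangentBundle (𝓡 m) M)) x)
    (s : M → 𝔼) (hs : MDifferentiableAt (𝓡 m) 𝓘(ℝ, 𝔼) s x)
    (hsσ : ∀ᶠ y in 𝓝 x, Ψ.dcoord y (σ y) = s y) (u : TangentSpace (𝓡 m) x) :
    Ψ.dcoord x (cov σ x u) = (show 𝔼 from mfderiv (𝓡 m) 𝓘(ℝ, 𝔼) s x u) +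
      christoffelForm (Ψ.christoffel cov) (Ψ x) (Ψ.dcoord x u) (s x) := by
  have hsi : ∀ i, HasMFDerivAt (𝓡 m) 𝓘(ℝ, ℝ) (fun y => s y i) x
      ((EuclideanSpace.proj i : 𝔼 →L[ℝ] ℝ).comp
        (show TangentSpace (𝓡 m) x →L[ℝ] 𝔼 from mfderiv (𝓡 m) 𝓘(ℝ, 𝔼) s x)) := fun i =>
    ((EuclideanSpace.proj i : 𝔼 →L[ℝ] ℝ).hasMFDerivAt).comp x hs.hasMFDerivAt
  -- Expand in the coordinate frame: the Leibniz rule then yields the derivative of the components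
  -- plus the Christoffel terms.
  have hsum : ∀ᶠ y in 𝓝 x, σ y = ∑ i, s y i • Ψ.coordFrame i y := by
    filter_upwards [hsσ, Ψ.open_source.mem_nhds hx] with y hy hyS
    rw [← hy]
    exact Ψ.eq_sum_coordFrame hyS (σ y)
  have hX := fun i => Ψ.mdifferentiableAt_coordFrame hx i
  rw [cov.isCovariantDerivativeOnUniv.congr_of_eventuallyEq hσ
    (MDifferentiableAt.sum_section (t := fun i => (fun y => s y i) • Ψ.coordFrame i)
      (s := Finset.univ) fun i _ => (hsi i).mdifferentiableAt.smul_section (hX i)) univ_mem hsum]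
  refine (congrArg (Ψ.dcoord x) (cov.sum_smul_apply Finset.univ (fun i y => s y i) Ψ.coordFrame x
    (fun i => (hsi i).mdifferentiableAt) hX u)).trans ?_
  simp only [map_sum, map_add, map_smul, (hsi _).mfderiv,
    Finset.sum_add_distrib]
  rw [add_comm]
  congr 1
  · have := (EuclideanSpace.basisFun (Fin m) ℝ).sum_repr
      (show 𝔼 from mfderiv (𝓡 m) 𝓘(ℝ, 𝔼) s x u)
    simp at this
    refine Eq.trans (Finset.sum_congr rfl fun i _ => ?_) this
    exact ((Ψ.dcoord x).map_smul _ _).trans (congrArg _ (Ψ.dcoord_coordFrame hx i))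
  · unfold christoffelForm christoffel
    rw [Ψ.symm_apply_apply hx, Finset.sum_comm]
    refine Finset.sum_congr rfl fun j _ => ?_
    conv_lhs => rw [Ψ.eq_sum_coordFrame hx u]
    simp only [map_sum, map_smul, Finset.smul_sum, smul_smul]
    refine Finset.sum_congr rfl fun i _ => ?_
    rw [mul_comm]

/-- The covariant derivative along a curve in the coordinates `Ψ`. -/
lemma dcoord_covDerivAlong (Ψ : PartialDiffeomorph (𝓡 m) 𝓘(ℝ, 𝔼) M 𝔼 ∞)
    (cov : CovariantDerivative (𝓡 m) 𝔼 (TangentSpace (𝓡 m) : M → Type _))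
    {γ : ℝ → M} {t : ℝ} (hx : γ t ∈ Ψ.source) (hγ : MDifferentiableAt 𝓘(ℝ, ℝ) (𝓡 m) γ t)
    (v : ∀ t : ℝ, TangentSpace (𝓡 m) (γ t)) {s : ℝ → 𝔼} (hs : DifferentiableAt ℝ s t)
    (hsv : ∀ᶠ τ in 𝓝 t, Ψ.dcoord (γ τ) (v τ) = s τ) :
    Ψ.dcoord (γ t) (covDerivAlong cov γ v t) = deriv s t +
      christoffelForm (Ψ.christoffel cov) (Ψ (γ t)) (Ψ.dcoord (γ t) (curveVelocity γ t)) (s t) := by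
  -- `covDerivAlong` is written in the preferred trivialization at `γ t`; `A` converts its
  -- components into those of `Ψ`.
  obtain ⟨A, hA, hAv⟩ := Ψ.exists_contMDiffAt_mfderiv_eq hx
  set T := trivializationAt 𝔼 (TangentSpace (𝓡 m) : M → Type _) (γ t) with hT
  have hb : ∀ᶠ x in 𝓝 (γ t), x ∈ T.baseSet :=
    T.open_baseSet.mem_nhds (FiberBundle.mem_baseSet_trivializationAt' (γ t))
  have hAT : ∀ᶠ x in 𝓝 (γ t), ∀ w : 𝔼, Ψ.dcoord x (T.symm x w) = A x w := by
    filter_upwards [hb, hAv] with x hxb hxA w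
    rw [hxA, T.apply_mk_symm hxb]
  have hinj : Function.Injective (A (γ t)) := by
    intro w₁ w₂ h
    rw [← hAT.self_of_nhds, ← hAT.self_of_nhds] at h
    have := Ψ.dcoord_injective hx h
    have h2 := congrArg (fun z : TangentSpace (𝓡 m) (γ t) => (T ⟨γ t, z⟩).2) this
    simpa only [T.apply_mk_symm hb.self_of_nhds] using h2
  set e : 𝔼 ≃L[ℝ] 𝔼 :=
    (LinearEquiv.ofInjectiveEndo (A (γ t) : 𝔼 →ₗ[ℝ] 𝔼) hinj).toContinuousLinearEquiv with he
  have heA : (e : 𝔼 →L[ℝ] 𝔼) = A (γ t) := by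
    ext w
    simp [he]
  have hAd := hA.mdifferentiableAt (by simp)
  have hAγ : HasDerivAt (fun τ => A (γ τ))
      (show 𝔼 →L[ℝ] 𝔼 from mfderiv (𝓡 m) 𝓘(ℝ, 𝔼 →L[ℝ] 𝔼) A (γ t) (curveVelocity γ t)) t := by
    have h : HasFDerivAt (fun τ => A (γ τ))
        (show ℝ →L[ℝ] (𝔼 →L[ℝ] 𝔼) from (mfderiv (𝓡 m) 𝓘(ℝ, 𝔼 →L[ℝ] 𝔼) A (γ t)).comp
          (mfderiv 𝓘(ℝ, ℝ) (𝓡 m) γ t)) t :=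
      (hAd.hasMFDerivAt.comp t hγ.hasMFDerivAt).hasFDerivAt
    exact h.hasDerivAt
  set w : ℝ → 𝔼 := fun τ => (T ⟨γ τ, v τ⟩).2 with hw
  have hsw : ∀ᶠ τ in 𝓝 t, s τ = A (γ τ) (w τ) := by
    filter_upwards [hsv, hγ.continuousAt.eventually hAv] with τ h1 h2
    rw [← h1, h2]
  -- Only the `Ψ`-components `s` are known to be differentiable; inverting `A` transfers this to the
  -- components `w` in the trivialization.
  have hws : ∀ᶠ τ in 𝓝 t, w τ = (A (γ τ)).inverse (s τ) := by
    have hev : ∀ᶠ τ in 𝓝 t, A (γ τ) ∈ range ((↑) : (𝔼 ≃L[ℝ] 𝔼) → 𝔼 →L[ℝ] 𝔼) :=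
      hAγ.continuousAt.eventually (by beta_reduce; rw [← heA]; exact ContinuousLinearEquiv.nhds e)
    filter_upwards [hsw, hev] with τ h1 h2
    obtain ⟨e', he'⟩ := h2
    rw [h1, ← he', ContinuousLinearMap.inverse_equiv]
    simp
  have hwd : DifferentiableAt ℝ w t := by
    refine DifferentiableAt.congr_of_eventuallyEq ?_ hws
    have h1 : DifferentiableAt ℝ ContinuousLinearMap.inverse (A (γ t)) := by
      rw [← heA]
      exact (contDiffAt_map_inverse (n := 1) e).differentiableAt (by simp)
    exact (h1.comp t hAγ.differentiableAt).clm_apply hs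
  have hds := (hAγ.clm_apply hwd.hasDerivAt).congr_of_eventuallyEq hsw
  rw [hds.deriv]
  unfold covDerivAlong
  rw [map_add, hAT.self_of_nhds]
  -- In `s' = A' w + A w'`, the term `A w'` is the first summand of `covDerivAlong`. The term `A' w`
  -- comes from the second: the field `extend (v t)` has the nonconstant `Ψ`-components `A x (w t)`.
  have hcov := Ψ.dcoord_cov cov hx (FiberBundle.extend 𝔼 (v t))
    (FiberBundle.mdifferentiableAt_extend ..)
    (fun x => A x (w t)) (hAd.clm_apply mdifferentiableAt_const)
    (hAT.mono fun _ h => h (w t)) (curveVelocity γ t)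
  rw [hcov, hsw.self_of_nhds]
  have hm : HasMFDerivAt (𝓡 m) 𝓘(ℝ, 𝔼) (fun x => A x (w t)) (γ t)
      ((ContinuousLinearMap.apply ℝ 𝔼 (w t)).comp
        (show TangentSpace (𝓡 m) (γ t) →L[ℝ] (𝔼 →L[ℝ] 𝔼) from
          mfderiv (𝓡 m) 𝓘(ℝ, 𝔼 →L[ℝ] 𝔼) A (γ t))) :=
    ((ContinuousLinearMap.apply ℝ 𝔼 (w t)).hasMFDerivAt).comp (γ t) hAd.hasMFDerivAt
  rw [hm.mfderiv]
  rw [← add_assoc]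
  congr 1
  exact add_comm _ _

end PartialDiffeomorph

end Christoffel

end

noncomputable section

/-! ### Smoothness of the Christoffel symbols. -/

section Christoffel

variable {m : ℕ} {M : Type*} [TopologicalSpace M] [ChartedSpace (EuclideanSpace ℝ (Fin m)) M]

local notation "𝔼" => EuclideanSpace ℝ (Fin m)

variable [IsManifold (𝓡 m) ∞ M]

namespace PartialDiffeomorph

lemma contMDiffAt_dcoord (Ψ : PartialDiffeomorph (𝓡 m) 𝓘(ℝ, 𝔼) M 𝔼 ∞) {x : M}
    (hx : x ∈ Ψ.source) (Z : ∀ x : M, TangentSpace (𝓡 m) x)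
    (hZ : ContMDiffAt (𝓡 m) ((𝓡 m).prod 𝓘(ℝ, 𝔼)) ∞
      (fun x => (⟨x, Z x⟩ : TangentBundle (𝓡 m) M)) x) :
    ContMDiffAt (𝓡 m) 𝓘(ℝ, 𝔼) ∞ (fun x => Ψ.dcoord x (Z x)) x := by
  obtain ⟨A, hA, hAv⟩ := Ψ.exists_contMDiffAt_mfderiv_eq hx
  refine (hA.clm_apply ((Bundle.contMDiffAt_section _).1 hZ)).congr_of_eventuallyEq ?_
  filter_upwards [hAv] with y hy
  exact hy _

/-- The Christoffel symbols of a smooth connection are smooth. -/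
lemma contDiffAt_christoffel [T2Space M]
    (Ψ : PartialDiffeomorph (𝓡 m) 𝓘(ℝ, 𝔼) M 𝔼 ∞)
    (cov : CovariantDerivative (𝓡 m) 𝔼 (TangentSpace (𝓡 m) : M → Type _))
    [hcov : CovariantDerivative.ContMDiffCovariantDerivative cov ∞] {q : M} (hq : q ∈ Ψ.source)
    (i j : Fin m) : ContDiffAt ℝ ∞ (Ψ.christoffel cov i j) (Ψ q) := by
  -- Smoothness of the connection is applied to globally smooth fields, while the frame is smooth
  -- only on `Ψ.source`. A bump function equal to `1` near `q` cuts it off without changing its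
  -- covariant derivatives near `q`.
  obtain ⟨f, -, hf⟩ := (SmoothBumpFunction.nhds_basis_tsupport (I := 𝓡 m) q).mem_iff.1
    (Ψ.open_source.mem_nhds hq)
  have hsm : ContMDiff (𝓡 m) ((𝓡 m).prod 𝓘(ℝ, 𝔼)) ∞
      (fun x => (⟨x, ((f : M → ℝ) • Ψ.coordFrame j) x⟩ : TangentBundle (𝓡 m) M)) :=
    ContMDiffOn.smul_section_of_tsupport f.contMDiff.contMDiffOn Ψ.open_source hf
      fun x hx => (Ψ.contMDiffAt_coordFrame hx j).contMDiffWithinAt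
  have h1 := hcov.contMDiff.contMDiff (σ := (f : M → ℝ) • Ψ.coordFrame j)
    (by simpa using hsm.contMDiffOn)
  have h2 := (h1 q (mem_univ q)).contMDiffAt univ_mem
  have h3 := h2.clm_bundle_apply (Ψ.contMDiffAt_coordFrame hq i)
  have h4 := Ψ.contMDiffAt_dcoord hq _ h3
  have h5 : ContMDiffAt 𝓘(ℝ, 𝔼) (𝓡 m) ∞ Ψ.symm (Ψ q) :=
    (Ψ.symm.contMDiffOn _ (Ψ.map_source hq)).contMDiffAt (Ψ.open_target.mem_nhds (Ψ.map_source hq))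
  have hqq : Ψ.symm (Ψ q) = q := Ψ.symm_apply_apply hq
  have h6 := (h4.comp_of_eq h5 hqq).contDiffAt
  refine h6.congr_of_eventuallyEq ?_
  have hev : ∀ᶠ x in 𝓝 q, f =ᶠ[𝓝 x] 1 := eventually_eventually_nhds.2 f.eventuallyEq_one
  have hT : Tendsto Ψ.symm (𝓝 (Ψ q)) (𝓝 q) := by
    have := h5.continuousAt.tendsto
    rwa [hqq] at this
  filter_upwards [hT.eventually hev, hT.eventually (Ψ.open_source.mem_nhds hq)] with y hy hyS
  unfold christoffel
  have h7 : cov (Ψ.coordFrame j) (Ψ.symm y) =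
      cov ((f : M → ℝ) • Ψ.coordFrame j) (Ψ.symm y) := by
    refine cov.isCovariantDerivativeOnUniv.congr_of_eventuallyEq
      (Ψ.mdifferentiableAt_coordFrame hyS j) (hsm.mdifferentiable (by simp) _) univ_mem ?_
    filter_upwards [hy] with z hz
    simp [hz]
  rw [h7]
  rfl

end PartialDiffeomorph

end Christoffel

end

noncomputable section

/-! ### Germs of smooth maps, parameter integrals, inverse function theorem. -/

section SmoothNear

/-- `f` is smooth on a neighbourhood of `a`. -/
def SmoothNear {E F : Type*} [NormedAddCommGroup E] [NormedSpace ℝ E] [NormedAddCommGroup F]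
    [NormedSpace ℝ F] (f : E → F) (a : E) : Prop :=
  ∀ᶠ z in 𝓝 a, ContDiffAt ℝ ∞ f z

namespace SmoothNear

variable {E F G : Type*} [NormedAddCommGroup E] [NormedSpace ℝ E] [NormedAddCommGroup F]
    [NormedSpace ℝ F] [NormedAddCommGroup G] [NormedSpace ℝ G] {f : E → F} {a : E}

lemma contDiffAt (h : SmoothNear f a) : ContDiffAt ℝ ∞ f a := h.self_of_nhds

lemma differentiableAt (h : SmoothNear f a) : DifferentiableAt ℝ f a :=
  h.contDiffAt.differentiableAt (by simp)

lemma eventually (h : SmoothNear f a) : ∀ᶠ z in 𝓝 a, SmoothNear f z :=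
  eventually_eventually_nhds.2 h

lemma of_contDiff (h : ContDiff ℝ ∞ f) : SmoothNear f a :=
  .of_forall fun _ => h.contDiffAt

lemma congr (h : SmoothNear f a) {g : E → F} (hg : g =ᶠ[𝓝 a] f) : SmoothNear g a := by
  filter_upwards [h, hg.eventuallyEq_nhds] with z h1 h2
  exact h1.congr_of_eventuallyEq h2

lemma comp {g : F → G} (a : E) {f : E → F} (hg : SmoothNear g (f a)) (hf : SmoothNear f a) :
    SmoothNear (fun x => g (f x)) a := by
  filter_upwards [hf, hf.contDiffAt.continuousAt.eventually hg] with z h1 h2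
  exact h2.comp z h1

lemma prodMk {g : E → G} (hf : SmoothNear f a) (hg : SmoothNear g a) :
    SmoothNear (fun x => (f x, g x)) a := by
  filter_upwards [hf, hg] with z h1 h2
  exact h1.prodMk h2

lemma add {g : E → F} (hf : SmoothNear f a) (hg : SmoothNear g a) :
    SmoothNear (fun x => f x + g x) a := by
  filter_upwards [hf, hg] with z h1 h2
  exact h1.add h2

lemma sub {g : E → F} (hf : SmoothNear f a) (hg : SmoothNear g a) :
    SmoothNear (fun x => f x - g x) a := by
  filter_upwards [hf, hg] with z h1 h2
  exact h1.sub h2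

lemma mul {f g : E → ℝ} (hf : SmoothNear f a) (hg : SmoothNear g a) :
    SmoothNear (fun x => f x * g x) a := by
  filter_upwards [hf, hg] with z h1 h2
  exact h1.mul h2

lemma smul {g : E → ℝ} (hg : SmoothNear g a) (hf : SmoothNear f a) :
    SmoothNear (fun x => g x • f x) a := by
  filter_upwards [hf, hg] with z h1 h2
  exact h2.smul h1

protected lemma fderiv (hf : SmoothNear f a) : SmoothNear (fderiv ℝ f) a := by
  filter_upwards [hf] with z h1
  exact h1.fderiv_right (by simp)

protected lemma deriv {f : ℝ → F} {a : ℝ} (hf : SmoothNear f a) : SmoothNear (deriv f) a := by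
  filter_upwards [hf] with z h1
  have : ContDiffAt ℝ ∞ (fun z => fderiv ℝ f z 1) z :=
    (h1.fderiv_right (by simp)).clm_apply contDiffAt_const
  exact this

end SmoothNear

/-- Differentiation under the integral sign. The tube lemma puts a closed ball times `[0, 1]` inside
`W`, and compactness bounds the derivative there by a constant. -/
lemma hasFDerivAt_integral_unitInterval {E F : Type} [NormedAddCommGroup E] [NormedSpace ℝ E]
    [FiniteDimensional ℝ E] [NormedAddCommGroup F] [NormedSpace ℝ F]
    {k : E × ℝ → F} {W : Set (E × ℝ)}
    (hW : IsOpen W) (hk : ContDiffOn ℝ ∞ k W) {z : E} (hz : ∀ θ ∈ Icc (0 : ℝ) 1, (z, θ) ∈ W) :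
    HasFDerivAt (fun z => ∫ θ in (0 : ℝ)..1, k (z, θ))
      (∫ θ in (0 : ℝ)..1, (fderiv ℝ k (z, θ)).comp (ContinuousLinearMap.inl ℝ E ℝ)) z := by
  obtain ⟨U, V, hU, hV, hzU, hV1, hUV⟩ := generalized_tube_lemma (isCompact_singleton (x := z))
    (isCompact_Icc (a := (0 : ℝ)) (b := 1)) hW (by rintro ⟨a, b⟩ ⟨rfl, hb⟩; exact hz b hb)
  obtain ⟨ε, hε, hεU⟩ := Metric.nhds_basis_closedBall.mem_iff.1 (hU.mem_nhds (hzU rfl))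
  have hsub : Metric.closedBall z ε ×ˢ Icc (0 : ℝ) 1 ⊆ W :=
    (prod_mono hεU hV1).trans hUV
  have hk' : ContinuousOn (fun p => (fderiv ℝ k p).comp (ContinuousLinearMap.inl ℝ E ℝ)) W :=
    ((hk.continuousOn_fderiv_of_isOpen hW (by simp))).clm_comp continuousOn_const
  obtain ⟨C, hC⟩ := ((isCompact_closedBall z ε).prod isCompact_Icc).exists_bound_of_continuousOn
    (hk'.mono hsub)
  have hint : ∀ x ∈ Metric.closedBall z ε, ContinuousOn (fun θ => k (x, θ)) (Icc 0 1) :=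
    fun x hx => hk.continuousOn.comp (by fun_prop) fun θ hθ => hsub ⟨hx, hθ⟩
  have huIoc : uIoc (0 : ℝ) 1 ⊆ Icc 0 1 := by
    rw [uIoc_of_le zero_le_one]
    exact Ioc_subset_Icc_self
  refine intervalIntegral.hasFDerivAt_integral_of_dominated_of_fderiv_le
    (F' := fun z θ => (fderiv ℝ k (z, θ)).comp (ContinuousLinearMap.inl ℝ E ℝ))
    (bound := fun _ => C) (Metric.ball_mem_nhds z hε) ?_ ?_ ?_ ?_ ?_ ?_
  · filter_upwards [Metric.closedBall_mem_nhds z hε] with x hx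
    exact ((hint x hx).mono huIoc).aestronglyMeasurable measurableSet_uIoc
  · exact (hint z (Metric.mem_closedBall_self hε.le)).intervalIntegrable_of_Icc zero_le_one
  · refine ContinuousOn.aestronglyMeasurable ?_ measurableSet_uIoc
    exact hk'.comp (by fun_prop) fun θ hθ => hsub ⟨Metric.mem_closedBall_self hε.le, huIoc hθ⟩
  · exact .of_forall fun θ hθ x hx => hC (x, θ) ⟨Metric.ball_subset_closedBall hx, huIoc hθ⟩
  · exact intervalIntegrable_const
  · refine .of_forall fun θ hθ x hx => ?_
    have h1 : (x, θ) ∈ W := hsub ⟨Metric.ball_subset_closedBall hx, huIoc hθ⟩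
    have h2 := ((hk.contDiffAt (hW.mem_nhds h1)).differentiableAt (by simp)).hasFDerivAt
    exact h2.comp x (hasFDerivAt_prodMk_left x θ)

/-- The derivative is an integral of the same kind with values in `E →L[ℝ] F`. Hence `F` and `k` are
quantified inside the induction, and `E`, `F` share a universe. -/
lemma contDiffOn_integral_unitInterval {E : Type} [NormedAddCommGroup E] [NormedSpace ℝ E]
    [FiniteDimensional ℝ E] {W : Set (E × ℝ)} (hW : IsOpen W) {U : Set E} (hU : IsOpen U)
    (hUW : U ×ˢ Icc (0 : ℝ) 1 ⊆ W) (n : ℕ) :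
    ∀ {F : Type} [NormedAddCommGroup F] [NormedSpace ℝ F] {k : E × ℝ → F}, ContDiffOn ℝ ∞ k W →
      ContDiffOn ℝ n (fun z => ∫ θ in (0 : ℝ)..1, k (z, θ)) U := by
  induction n with
  | zero =>
    intro F _ _ k hk
    refine contDiffOn_zero.2 fun z hz => ?_
    exact (hasFDerivAt_integral_unitInterval hW hk
      fun θ hθ => hUW ⟨hz, hθ⟩).continuousAt.continuousWithinAt
  | succ n ih =>
    intro F _ _ k hk
    have hd := fun z (hz : z ∈ U) => hasFDerivAt_integral_unitInterval hW hk
      fun θ hθ => hUW ⟨hz, hθ⟩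
    push_cast
    rw [contDiffOn_succ_iff_fderiv_of_isOpen hU]
    refine ⟨fun z hz => (hd z hz).differentiableAt.differentiableWithinAt, by simp, ?_⟩
    have hk' : ContDiffOn ℝ ∞ (fun p => (fderiv ℝ k p).comp (ContinuousLinearMap.inl ℝ E ℝ)) W :=
      (hk.fderiv_of_isOpen hW (by simp)).clm_comp contDiffOn_const
    exact (ih hk').congr fun z hz => (hd z hz).fderiv

/-- Integrals over the unit interval depend smoothly on parameters. -/
lemma SmoothNear.integral {E F : Type} [NormedAddCommGroup E] [NormedSpace ℝ E]
    [FiniteDimensional ℝ E] [NormedAddCommGroup F] [NormedSpace ℝ F] {k : E × ℝ → F} {z : E}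
    (hk : ∀ θ ∈ Icc (0 : ℝ) 1, SmoothNear k (z, θ)) :
    SmoothNear (fun z => ∫ θ in (0 : ℝ)..1, k (z, θ)) z := by
  have hW : IsOpen {p | SmoothNear k p} := isOpen_setOfPred_eventually_nhds
  have hkW : ContDiffOn ℝ ∞ k {p | SmoothNear k p} := fun p hp => hp.contDiffAt.contDiffWithinAt
  obtain ⟨U, V, hU, hV, hzU, hV1, hUV⟩ := generalized_tube_lemma (isCompact_singleton (x := z))
    (isCompact_Icc (a := (0 : ℝ)) (b := 1)) hW (by rintro ⟨a, b⟩ ⟨rfl, hb⟩; exact hk b hb)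
  have hc : ContDiffOn ℝ ∞ (fun z => ∫ θ in (0 : ℝ)..1, k (z, θ)) U :=
    contDiffOn_infty.2 fun n =>
      contDiffOn_integral_unitInterval hW hU ((prod_mono subset_rfl hV1).trans hUV) n hkW
  filter_upwards [hU.mem_nhds (hzU rfl)] with x hx
  exact hc.contDiffAt (hU.mem_nhds hx)

/-- The inverse function theorem for smooth maps. -/
lemma SmoothNear.exists_openPartialHomeomorph {E F : Type*} [NormedAddCommGroup E]
    [NormedSpace ℝ E] [CompleteSpace E] [NormedAddCommGroup F] [NormedSpace ℝ F]
    {f : E → F} {a : E} (hf : SmoothNear f a) {e : E ≃L[ℝ] F}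
    (he : HasFDerivAt f (e : E →L[ℝ] F) a) :
    ∃ h : OpenPartialHomeomorph E F, a ∈ h.source ∧ (∀ x, h x = f x) ∧
      ContDiffOn ℝ ∞ h h.source ∧ ContDiffOn ℝ ∞ h.symm h.target := by
  set h₀ := hf.contDiffAt.toOpenPartialHomeomorph f he (by simp) with hh₀
  have ha₀ : a ∈ h₀.source := hf.contDiffAt.mem_toOpenPartialHomeomorph_source he (by simp)
  -- Shrink the source to points where the derivative is invertible, so that the inverse is smooth
  -- on the whole target.
  have hev : ∀ᶠ z in 𝓝 a, SmoothNear f z ∧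
      fderiv ℝ f z ∈ range ((↑) : (E ≃L[ℝ] F) → E →L[ℝ] F) := by
    refine hf.eventually.and (hf.fderiv.contDiffAt.continuousAt.eventually ?_)
    rw [he.fderiv]
    exact ContinuousLinearEquiv.nhds e
  obtain ⟨S, hS, hSo, haS⟩ := eventually_nhds_iff.1 hev
  refine ⟨h₀.restrOpen S hSo, ⟨ha₀, haS⟩, fun x => rfl, ?_, ?_⟩
  · intro x hx
    exact (hS x hx.2).1.contDiffAt.contDiffWithinAt
  · intro y hy
    have hx : (h₀.restrOpen S hSo).symm y ∈ S := ((h₀.restrOpen S hSo).map_target hy).2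
    obtain ⟨h1, e', he'⟩ := hS _ hx
    refine ((h₀.restrOpen S hSo).contDiffAt_symm hy (f₀' := e') ?_ h1.contDiffAt).contDiffWithinAt
    rw [he']
    exact h1.differentiableAt.hasFDerivAt

end SmoothNear

end

noncomputable section

/-! ### Smooth reparametrization of the rulings. -/

section Reparametrization

/-- Vanishing along the axis kills the partial derivative in `t`, so the differential is determined
by the one in `s`. -/
lemma hasFDerivAt_of_vanishing_on_axis {f : ℝ × ℝ → ℝ} {t₀ c : ℝ}
    (hf : DifferentiableAt ℝ f (t₀, 0)) (h0 : ∀ᶠ t in 𝓝 t₀, f (t, 0) = 0)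
    (hc : HasDerivAt (fun s => f (t₀, s)) c 0) :
    HasFDerivAt f (c • ContinuousLinearMap.snd ℝ ℝ ℝ) (t₀, 0) := by
  have h1 : HasDerivAt (fun t => f (t, 0)) (fderiv ℝ f (t₀, 0) (1, 0)) t₀ :=
    hf.hasFDerivAt.comp_hasDerivAt t₀ ((hasDerivAt_id t₀).prodMk (hasDerivAt_const t₀ (0 : ℝ)))
  have h2 : HasDerivAt (fun s => f (t₀, s)) (fderiv ℝ f (t₀, 0) (0, 1)) 0 :=
    hf.hasFDerivAt.comp_hasDerivAt (0 : ℝ) ((hasDerivAt_const (0 : ℝ) t₀).prodMk (hasDerivAt_id 0))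
  have h3 : fderiv ℝ f (t₀, 0) (1, 0) = 0 :=
    h1.unique ((hasDerivAt_const t₀ (0 : ℝ)).congr_of_eventuallyEq h0)
  have h4 := h2.unique hc
  convert hf.hasFDerivAt using 1
  ext
  · simp [h3]
  · simp [h4]

/-- The substitution `τ = sθ` moves the variable endpoint into the integrand. -/
lemma SmoothNear.primitive {k : ℝ × ℝ → ℝ} {t₀ : ℝ} (hk : SmoothNear k (t₀, 0)) :
    SmoothNear (fun z : ℝ × ℝ => ∫ τ in (0 : ℝ)..z.2, k (z.1, τ)) (t₀, 0) := by
  have h : ∀ z : ℝ × ℝ, ∫ τ in (0 : ℝ)..z.2, k (z.1, τ) =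
      z.2 * ∫ θ in (0 : ℝ)..1, k (z.1, z.2 * θ) := by
    intro z
    rw [intervalIntegral.mul_integral_comp_mul_left (f := fun τ => k (z.1, τ))]
    simp
  refine SmoothNear.congr ?_ (.of_forall h)
  refine (SmoothNear.of_contDiff contDiff_snd).mul
    (SmoothNear.integral (k := fun p : (ℝ × ℝ) × ℝ => k (p.1.1, p.1.2 * p.2)) fun θ _ => ?_)
  refine SmoothNear.comp (g := k) (f := fun p : (ℝ × ℝ) × ℝ => (p.1.1, p.1.2 * p.2)) _ ?_
    (SmoothNear.of_contDiff (by fun_prop))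
  simpa using hk

lemma SmoothNear.hasDerivAt_primitive {k : ℝ × ℝ → ℝ} {t₀ : ℝ} (hk : SmoothNear k (t₀, 0)) :
    ∀ᶠ z : ℝ × ℝ in 𝓝 (t₀, 0),
      HasDerivAt (fun ρ => ∫ τ in (0 : ℝ)..ρ, k (z.1, τ)) (k z) z.2 := by
  obtain ⟨ε, hε, h⟩ := Metric.eventually_nhds_iff_ball.1 hk
  filter_upwards [Metric.ball_mem_nhds _ hε] with z hz
  rw [← ball_prod_same] at h hz
  have hc : ContinuousOn (fun τ => k (z.1, τ)) (Metric.ball 0 ε) := fun τ hτ =>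
    ((h (z.1, τ) ⟨hz.1, hτ⟩).continuousAt.comp
      (f := fun τ : ℝ => (z.1, τ)) (by fun_prop)).continuousWithinAt
  have hsub : uIcc 0 z.2 ⊆ Metric.ball 0 ε :=
    (convex_ball (0 : ℝ) ε).ordConnected.uIcc_subset (Metric.mem_ball_self hε) hz.2
  exact intervalIntegral.integral_hasDerivAt_right (hc.mono hsub).intervalIntegrable
    (hc.stronglyMeasurableAtFilter Metric.isOpen_ball _ hz.2)
    (hc.continuousAt (Metric.isOpen_ball.mem_nhds hz.2))

/-- The family of scalar initial value problems `r'' = -κ(t, r) (r')²`, `r(0) = 0`, `r'(0) = 1`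
has a solution which is smooth in the parameter `t`. -/
lemma SmoothNear.exists_affine_reparametrization {κ : ℝ × ℝ → ℝ} {t₀ : ℝ}
    (hκ : SmoothNear κ (t₀, 0)) :
    ∃ r r₁ : ℝ × ℝ → ℝ, SmoothNear r (t₀, 0) ∧ (∀ᶠ t in 𝓝 t₀, r (t, 0) = 0 ∧ r₁ (t, 0) = 1) ∧
      ∀ᶠ z : ℝ × ℝ in 𝓝 (t₀, 0), HasDerivAt (fun s => r (z.1, s)) (r₁ z) z.2 ∧
        HasDerivAt (fun s => r₁ (z.1, s)) (-(κ (z.1, r z) * r₁ z ^ 2)) z.2 := by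
  -- Viewed as a function of `r`, the velocity satisfies `(log r')' = -κ`, so `r' = exp (-L(t, r))`
  -- with `L` a primitive of `κ`. With `P` a primitive of `exp L` this reads `P(t, r(t, s)) = s`.
  -- Inverting `(t, ρ) ↦ (t, P(t, ρ))` therefore gives `r`, smooth in both variables.
  set L : ℝ × ℝ → ℝ := fun z => ∫ τ in (0 : ℝ)..z.2, κ (z.1, τ) with hL
  have hLs : SmoothNear L (t₀, 0) := hκ.primitive
  have hLd : ∀ᶠ z : ℝ × ℝ in 𝓝 (t₀, 0), HasDerivAt (fun ρ => L (z.1, ρ)) (κ z) z.2 :=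
    hκ.hasDerivAt_primitive
  have hL0 : ∀ t, L (t, 0) = 0 := fun t => by simp [hL]
  have hexp : SmoothNear (fun z => Real.exp (L z)) (t₀, 0) :=
    SmoothNear.comp _ (g := Real.exp) (SmoothNear.of_contDiff Real.contDiff_exp) hLs
  set P : ℝ × ℝ → ℝ := fun z => ∫ τ in (0 : ℝ)..z.2, Real.exp (L (z.1, τ)) with hP
  have hPs : SmoothNear P (t₀, 0) := hexp.primitive
  have hPd : ∀ᶠ z : ℝ × ℝ in 𝓝 (t₀, 0), HasDerivAt (fun ρ => P (z.1, ρ)) (Real.exp (L z)) z.2 :=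
    hexp.hasDerivAt_primitive
  have hP0 : ∀ t, P (t, 0) = 0 := fun t => by simp [hP]
  have hPf : HasFDerivAt P (ContinuousLinearMap.snd ℝ ℝ ℝ) (t₀, 0) := by
    have := hasFDerivAt_of_vanishing_on_axis hPs.differentiableAt (.of_forall hP0)
      hPd.self_of_nhds
    simpa [hL0] using this
  have hH : HasFDerivAt (fun z : ℝ × ℝ => (z.1, P z))
      (ContinuousLinearEquiv.refl ℝ (ℝ × ℝ) : (ℝ × ℝ) →L[ℝ] ℝ × ℝ) (t₀, 0) :=
    hasFDerivAt_fst.prodMk hPf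
  obtain ⟨h, hsrc, hcoe, hsm, hsms⟩ := SmoothNear.exists_openPartialHomeomorph
    ((SmoothNear.of_contDiff contDiff_fst).prodMk hPs) hH
  have h0 : h (t₀, 0) = (t₀, 0) := by rw [hcoe, hP0]
  have htgt : ((t₀, 0) : ℝ × ℝ) ∈ h.target := h0 ▸ h.map_source hsrc
  have hsymm0 : h.symm (t₀, 0) = (t₀, 0) := by
    conv_lhs => rw [← h0]
    exact h.left_inv hsrc
  have hfst : ∀ z ∈ h.target, h.symm z = (z.1, (h.symm z).2) ∧ P (z.1, (h.symm z).2) = z.2 := by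
    intro z hz
    have h1 := h.right_inv hz
    rw [hcoe] at h1
    have h2 : (h.symm z).1 = z.1 := (Prod.ext_iff.1 h1).1
    have h3 : P (h.symm z) = z.2 := (Prod.ext_iff.1 h1).2
    have h4 : h.symm z = (z.1, (h.symm z).2) := Prod.ext h2 rfl
    exact ⟨h4, h4 ▸ h3⟩
  have hT : Tendsto h.symm (𝓝 (t₀, 0)) (𝓝 (t₀, 0)) := by
    have := (h.continuousAt_symm htgt).tendsto
    rwa [hsymm0] at this
  have hevt : ∀ᶠ z in 𝓝 ((t₀, 0) : ℝ × ℝ), z ∈ h.target := h.open_target.mem_nhds htgt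
  refine ⟨fun z => (h.symm z).2, fun z => Real.exp (-L (z.1, (h.symm z).2)), ?_, ?_, ?_⟩
  · filter_upwards [hevt] with z hz
    exact contDiff_snd.contDiffAt.comp z (hsms.contDiffAt (h.open_target.mem_nhds hz))
  · have : ∀ᶠ t in 𝓝 t₀, ((t, 0) : ℝ × ℝ) ∈ h.source :=
      (by fun_prop : Continuous fun t : ℝ => ((t, 0) : ℝ × ℝ)).continuousAt.eventually
        (h.open_source.mem_nhds hsrc)
    filter_upwards [this] with t ht
    have h1 : h.symm (t, 0) = (t, 0) := by
      have := h.left_inv ht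
      rwa [hcoe, hP0] at this
    simp [h1, hL0]
  · filter_upwards [hevt, hT.eventually hLd, hT.eventually hPd] with z hz hzL hzP
    have hline : ContinuousAt (fun s : ℝ => (z.1, s)) z.2 := by fun_prop
    have hev : ∀ᶠ s in 𝓝 z.2, (z.1, s) ∈ h.target :=
      hline.eventually (h.open_target.mem_nhds hz)
    obtain ⟨h1, -⟩ := hfst z hz
    set r := (h.symm z).2 with hr
    rw [h1] at hzL hzP
    have hrc : ContinuousAt (fun s => (h.symm (z.1, s)).2) z.2 :=
      continuous_snd.continuousAt.comp
        (ContinuousAt.comp (f := fun s : ℝ => (z.1, s)) (h.continuousAt_symm hz) hline)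
    have hd : HasDerivAt (fun s => (h.symm (z.1, s)).2) (Real.exp (-L (z.1, r))) z.2 := by
      rw [Real.exp_neg]
      refine HasDerivAt.of_local_left_inverse (f := fun ρ => P (z.1, ρ)) hrc hzP
        (Real.exp_pos _).ne' ?_
      filter_upwards [hev] with s hs
      exact (hfst _ hs).2
    refine ⟨hd, ?_⟩
    have hcomp : HasDerivAt (fun s => L (z.1, (h.symm (z.1, s)).2))
        (κ (z.1, r) * Real.exp (-L (z.1, r))) z.2 :=
      HasDerivAt.comp z.2 (h₂ := fun ρ => L (z.1, ρ)) hzL hd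
    refine hcomp.fun_neg.exp.congr_deriv ?_
    ring

end Reparametrization

end

noncomputable section

/-! ### Folds are generically two-to-one. -/

section TwoToOne

/-- The second coordinate is `(t + s)² - s²`, so a value of the model determines exactly `t + s` and
`s²`. -/
lemma foldModel_eq_iff {m : ℕ} (hm : 2 ≤ m) (z w : ℝ × ℝ) :
    foldModel m z = foldModel m w ↔ z.1 + z.2 = w.1 + w.2 ∧ (z.2 = w.2 ∨ z.2 = -w.2) := by
  have h : foldModel m z = foldModel m w ↔
      z.1 + z.2 = w.1 + w.2 ∧ z.1 ^ 2 + 2 * z.2 * z.1 = w.1 ^ 2 + 2 * w.2 * w.1 := by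
    constructor
    · intro h
      have h0 := congrArg (fun v : EuclideanSpace ℝ (Fin m) => v ⟨0, by omega⟩) h
      have h1 := congrArg (fun v : EuclideanSpace ℝ (Fin m) => v ⟨1, by omega⟩) h
      exact ⟨by simpa [foldModel] using h0, by simpa [foldModel] using h1⟩
    · rintro ⟨h0, h1⟩
      simp only [foldModel, h0, h1]
  rw [h, and_congr_right_iff]
  intro h0
  have h1 : z.1 = w.1 + w.2 - z.2 := by linarith
  rw [h1, ← sq_eq_sq_iff_eq_or_eq_neg]
  constructor <;> intro h <;> nlinarith

/-- A fold is generically two-to-one. -/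
lemma IsFoldAt.isGenericallyTwoToOneAt {m : ℕ} (hm : 2 ≤ m) {M : Type*} [TopologicalSpace M]
    [ChartedSpace (EuclideanSpace ℝ (Fin m)) M] {f : ℝ × ℝ → M} {p : ℝ × ℝ}
    (hf : IsFoldAt m f p) : IsGenericallyTwoToOneAt f p := by
  obtain ⟨hsm, σ, τ, ⟨S, hpS, hσS⟩, hσp, ⟨T, hpT, hτT⟩, -, hmod⟩ := hf
  intro N hN
  have hcont : ContinuousAt f p := hsm.self_of_nhds.continuousAt
  have hSp : S p = 0 := by rw [← hσS hpS, hσp]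
  have hS0 : (0 : ℝ × ℝ) ∈ S.target := hSp ▸ S.map_source hpS
  have hsymm0 : S.symm 0 = p := by
    rw [← hSp]
    exact S.left_inv hpS
  have hSsymm : ∀ y ∈ S.target, ContinuousAt S.symm y := fun y hy =>
    S.toOpenPartialHomeomorph.continuousAt_symm hy
  have hS : ∀ x ∈ S.source, ContinuousAt S x := fun x hx =>
    S.toOpenPartialHomeomorph.continuousAt hx
  have hgood : ∀ᶠ z in 𝓝 p, z ∈ N ∧ f z ∈ T.source ∧ τ (f z) = foldModel m (σ z) :=
    (show ∀ᶠ z in 𝓝 p, z ∈ N from hN).and ((hcont.eventually (T.open_source.mem_nhds hpT)).and hmod)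
  have hev : ∀ᶠ y in 𝓝 (0 : ℝ × ℝ), y ∈ S.target ∧
      (S.symm y ∈ N ∧ f (S.symm y) ∈ T.source ∧ τ (f (S.symm y)) = foldModel m (σ (S.symm y))) := by
    refine (show ∀ᶠ y in 𝓝 (0 : ℝ × ℝ), y ∈ S.target from S.open_target.mem_nhds hS0).and ?_
    have h := (hSsymm 0 hS0).tendsto
    rw [hsymm0] at h
    exact h.eventually hgood
  obtain ⟨ε, hε, hball⟩ := Metric.eventually_nhds_iff_ball.1 hev
  -- `B` is invariant under the involution `(t, s) ↦ (t + 2s, -s)` exchanging the points of a fibre,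
  -- so partners do not leave the neighbourhood.
  set B : Set (ℝ × ℝ) := {y | |y.1 + y.2| < ε / 4 ∧ |y.2| < ε / 4} with hB
  have hBo : IsOpen B :=
    (isOpen_lt (f := fun y : ℝ × ℝ => |y.1 + y.2|) (by fun_prop) continuous_const).inter
      (isOpen_lt (f := fun y : ℝ × ℝ => |y.2|) (by fun_prop) continuous_const)
  have hBball : B ⊆ Metric.ball 0 ε := by
    rintro y ⟨h1, h2⟩
    rw [abs_lt] at h1 h2
    rw [mem_ball_zero_iff, Prod.norm_def, sup_lt_iff, Real.norm_eq_abs, Real.norm_eq_abs, abs_lt,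
      abs_lt]
    constructor <;> constructor <;> linarith
  have hSo := S.toOpenPartialHomeomorph.isOpen_inter_preimage hBo
  have hWgood : ∀ x ∈ S.source, S x ∈ B → x ∈ N ∧ f x ∈ T.source ∧ τ (f x) = foldModel m (S x) := by
    intro x hx hxB
    have := (hball _ (hBball hxB)).2
    rw [show S.symm (S x) = x from S.left_inv hx] at this
    rwa [← hσS hx]
  have hfib : ∀ x ∈ S.source ∩ S ⁻¹' B, ∀ x' ∈ S.source ∩ S ⁻¹' B,
      (f x' = f x ↔ foldModel m (S x') = foldModel m (S x)) := by
    intro x hx x' hx'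
    obtain ⟨-, h1, h2⟩ := hWgood x hx.1 hx.2
    obtain ⟨-, h1', h2'⟩ := hWgood x' hx'.1 hx'.2
    rw [← h2, ← h2']
    refine ⟨fun h => by rw [h], fun h => ?_⟩
    rw [hτT h1, hτT h1'] at h
    exact T.injOn h1' h1 h
  refine ⟨S.source ∩ S ⁻¹' B, fun x hx => (hWgood x hx.1 hx.2).1, hSo, ⟨hpS, ?_⟩,
    S.source ∩ S ⁻¹' (B ∩ {y | y.2 ≠ 0}), fun x hx => ⟨hx.1, hx.2.1⟩, ?_, ?_, ?_⟩
  · change S p ∈ B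
    rw [hSp]
    simp [hB, hε]
  · exact S.toOpenPartialHomeomorph.isOpen_inter_preimage
      (hBo.inter (isOpen_ne_fun continuous_snd continuous_const))
  · rintro x ⟨hx, hxB⟩
    have hxt : S x ∈ S.target := S.map_source hx
    -- Density: a small nonzero shift of the second coordinate leaves the fold line `s = 0`.
    set c : ℝ → ℝ × ℝ := fun δ => ((S x).1, (S x).2 + δ) with hc
    have hcc : Continuous c := by fun_prop
    have hc0 : c 0 = S x := by simp [hc]
    have hlim : Tendsto (fun δ => S.symm (c δ)) (𝓝[≠] 0) (𝓝 x) := by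
      have h1 : ContinuousAt (fun δ => S.symm (c δ)) 0 :=
        ContinuousAt.comp (by rw [hc0]; exact hSsymm _ hxt) hcc.continuousAt
      have h2 := h1.tendsto
      rw [hc0, show S.symm (S x) = x from S.left_inv hx] at h2
      exact h2.mono_left nhdsWithin_le_nhds
    refine mem_closure_of_tendsto hlim ?_
    have h1 : ∀ᶠ δ in 𝓝[≠] (0 : ℝ), c δ ∈ S.target ∩ B :=
      nhdsWithin_le_nhds (hcc.continuousAt.eventually
        ((S.open_target.inter hBo).mem_nhds (by rw [hc0]; exact ⟨hxt, hxB⟩)))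
    have h2 : ∀ᶠ δ in 𝓝[≠] (0 : ℝ), (c δ).2 ≠ 0 := by
      by_cases h0 : (S x).2 = 0
      · filter_upwards [self_mem_nhdsWithin] with δ hδ
        simpa [hc, h0] using hδ
      · refine nhdsWithin_le_nhds ((by fun_prop : Continuous fun δ => (c δ).2).continuousAt.eventually
          (isOpen_ne.mem_nhds ?_))
        simpa [hc] using h0
    filter_upwards [h1, h2] with δ h1 h2
    have h3 : S (S.symm (c δ)) = c δ := S.right_inv h1.1
    refine ⟨S.map_target h1.1, ?_⟩
    rw [mem_preimage, h3]
    exact ⟨h1.2, h2⟩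
  · rintro x ⟨hx, hxB, hx0⟩
    set y : ℝ × ℝ := ((S x).1 + 2 * (S x).2, -(S x).2) with hy
    have hyB : y ∈ B := by
      refine ⟨?_, ?_⟩
      · have : y.1 + y.2 = (S x).1 + (S x).2 := by simp only [hy]; ring
        rw [this]
        exact hxB.1
      · simpa [hy] using hxB.2
    have hyt : y ∈ S.target := (hball y (hBball hyB)).1
    have hSy : S (S.symm y) = y := S.right_inv hyt
    have hyW : S.symm y ∈ S.source ∩ S ⁻¹' B := by
      refine ⟨S.map_target hyt, ?_⟩
      change S (S.symm y) ∈ B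
      rwa [hSy]
    rw [Set.ncard_eq_two]
    refine ⟨x, S.symm y, ?_, ?_⟩
    · intro h
      have h1 : (S x).2 = y.2 := by rw [h, hSy]
      simp only [hy] at h1
      exact hx0 (by linarith)
    · ext w
      simp only [mem_ofPred_eq, mem_insert_iff, mem_singleton_iff]
      constructor
      · rintro ⟨hw, hfw⟩
        rw [hfib x ⟨hx, hxB⟩ w hw, foldModel_eq_iff hm] at hfw
        obtain ⟨h1, h2 | h2⟩ := hfw
        · left
          refine S.injOn hw.1 hx (Prod.ext ?_ h2)
          have : (S w).1 + (S w).2 = (S x).1 + (S x).2 := h1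
          linarith
        · right
          refine S.injOn hw.1 hyW.1 ?_
          refine Eq.trans ?_ hSy.symm
          refine Prod.ext ?_ h2
          have : (S w).1 + (S w).2 = (S x).1 + (S x).2 := h1
          simp only [hy]
          linarith
      · rintro (rfl | rfl)
        · exact ⟨⟨hx, hxB⟩, rfl⟩
        · refine ⟨hyW, ?_⟩
          rw [hfib x ⟨hx, hxB⟩ _ hyW, hSy, foldModel_eq_iff hm]
          refine ⟨?_, Or.inr rfl⟩
          simp only [hy]
          ring

end TwoToOne

end

noncomputable section

/-! ### Normal form for the tangent lines of a plane curve. -/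

section FoldNormalForm

/-- Near a point where `x' = 1`, the planar curve `(x, y)` is the graph of a smooth function. -/
lemma SmoothNear.exists_graph {x y : ℝ → ℝ} {t₀ : ℝ} (hx : SmoothNear x t₀) (hy : SmoothNear y t₀)
    (hx1 : deriv x t₀ = 1) :
    ∃ h : ℝ → ℝ, SmoothNear h (x t₀) ∧ ∀ᶠ t in 𝓝 t₀, h (x t) = y t := by
  have he : HasFDerivAt x (ContinuousLinearEquiv.refl ℝ ℝ : ℝ →L[ℝ] ℝ) t₀ := by
    have := hx.differentiableAt.hasDerivAt.hasFDerivAt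
    rw [hx1] at this
    refine this.congr_fderiv ?_
    ext
    simp
  obtain ⟨e, hsrc, hcoe, -, hsym⟩ := hx.exists_openPartialHomeomorph he
  have htgt : x t₀ ∈ e.target := hcoe t₀ ▸ e.map_source hsrc
  have hinv : ∀ t ∈ e.source, e.symm (x t) = t := fun t ht => hcoe t ▸ e.left_inv ht
  refine ⟨fun X => y (e.symm X), SmoothNear.comp (x t₀) ((hinv t₀ hsrc).symm ▸ hy) ?_, ?_⟩
  · filter_upwards [e.open_target.mem_nhds htgt] with X hX
    exact hsym.contDiffAt (e.open_target.mem_nhds hX)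
  · filter_upwards [e.open_source.mem_nhds hsrc] with t ht
    rw [hinv t ht]

/-- Second order Taylor formula with a smooth remainder. -/
lemma SmoothNear.exists_taylor_two {h : ℝ → ℝ} (hh : SmoothNear h 0) :
    ∃ k : ℝ × ℝ → ℝ, SmoothNear k (0, 0) ∧ k (0, 0) = deriv (deriv h) 0 / 2 ∧
      ∀ᶠ z : ℝ × ℝ in 𝓝 (0, 0), z.2 ^ 2 * k z = h (z.1 + z.2) - h z.1 - z.2 * deriv h z.1 := by
  refine ⟨fun z => ∫ θ in (0 : ℝ)..1, (1 - θ) * deriv (deriv h) (z.1 + θ * z.2), ?_, ?_, ?_⟩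
  · refine SmoothNear.integral
      (k := fun p : (ℝ × ℝ) × ℝ => (1 - p.2) * deriv (deriv h) (p.1.1 + p.2 * p.1.2)) fun θ _ => ?_
    refine (SmoothNear.of_contDiff (by fun_prop)).mul ?_
    refine SmoothNear.comp (g := deriv (deriv h))
      (f := fun p : (ℝ × ℝ) × ℝ => p.1.1 + p.2 * p.1.2) _ ?_ (SmoothNear.of_contDiff (by fun_prop))
    simpa using hh.deriv.deriv
  · have : ∫ θ in (0 : ℝ)..1, (1 - θ) = 1 / 2 := by
      rw [intervalIntegral.integral_sub (by simp) (by simp)]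
      norm_num
    simp [this]
    ring
  · obtain ⟨ε, hε, hball⟩ :=
      Metric.eventually_nhds_iff_ball.1 (hh.and (hh.deriv.and hh.deriv.deriv))
    filter_upwards [Metric.ball_mem_nhds ((0 : ℝ), (0 : ℝ)) (half_pos hε)] with z hz
    rw [← ball_prod_same] at hz
    have h1 := hz.1
    have h2 := hz.2
    rw [Real.ball_eq_Ioo] at h1 h2
    have hin : ∀ θ ∈ uIcc (0 : ℝ) 1, z.1 + θ * z.2 ∈ Metric.ball (0 : ℝ) ε := by
      intro θ hθ
      rw [uIcc_of_le zero_le_one] at hθ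
      rw [Real.ball_eq_Ioo]
      constructor <;> nlinarith [hθ.1, hθ.2, h1.1, h1.2, h2.1, h2.2]
    have hline : ∀ θ : ℝ, HasDerivAt (fun θ : ℝ => z.1 + θ * z.2) z.2 θ := fun θ => by
      simpa using ((hasDerivAt_id θ).mul_const z.2).const_add z.1
    -- An antiderivative in `θ` of `z.2 ^ 2` times the remainder integrand; its increment over `[0,
    -- 1]` is the right-hand side of Taylor's formula.
    have hF : ∀ θ ∈ uIcc (0 : ℝ) 1, HasDerivAt
        (fun θ => h (z.1 + θ * z.2) + (1 - θ) * z.2 * deriv h (z.1 + θ * z.2))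
        (z.2 ^ 2 * ((1 - θ) * deriv (deriv h) (z.1 + θ * z.2))) θ := by
      intro θ hθ
      obtain ⟨a1, a2, -⟩ := hball _ (hin θ hθ)
      have b1 := HasDerivAt.comp θ (a1.differentiableAt (by simp)).hasDerivAt (hline θ)
      have b2 := HasDerivAt.comp θ (a2.differentiableAt (by simp)).hasDerivAt (hline θ)
      have b3 := (((hasDerivAt_id θ).const_sub 1).mul_const z.2).mul b2
      refine (b1.add b3).congr_deriv ?_
      simp only [Function.comp, id]
      ring
    have hcont : ContinuousOn (fun θ => z.2 ^ 2 * ((1 - θ) * deriv (deriv h) (z.1 + θ * z.2)))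
        (uIcc 0 1) := by
      refine continuousOn_const.mul (ContinuousOn.mul (by fun_prop) fun θ hθ => ?_)
      exact (ContinuousAt.comp (f := fun θ => z.1 + θ * z.2)
        (hball _ (hin θ hθ)).2.2.continuousAt (by fun_prop)).continuousWithinAt
    have := intervalIntegral.integral_eq_sub_of_hasDerivAt hF hcont.intervalIntegrable
    rw [intervalIntegral.integral_const_mul] at this
    rw [this]
    simp
    ring

/-- The tangent developable of a planar curve with nonvanishing curvature, with the rulings
reparametrized, is a fold in suitable coordinates. -/
theorem exists_fold_normal_form {x y : ℝ → ℝ} {t₀ : ℝ} {r : ℝ × ℝ → ℝ}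
    (hx : SmoothNear x t₀) (hy : SmoothNear y t₀) (hr : SmoothNear r (t₀, 0))
    (hx0 : x t₀ = 0) (hy0 : y t₀ = 0) (hx1 : deriv x t₀ = 1) (hy1 : deriv y t₀ = 0)
    (hy2 : deriv (deriv y) t₀ = 1)
    (hr0 : ∀ᶠ t in 𝓝 t₀, r (t, 0) = 0) (hr1 : HasDerivAt (fun s => r (t₀, s)) 1 0) :
    ∃ (H : ℝ → ℝ) (a b : ℝ × ℝ → ℝ), SmoothNear H 0 ∧ H 0 = 0 ∧ SmoothNear a (t₀, 0) ∧
      SmoothNear b (t₀, 0) ∧ a (t₀, 0) = 0 ∧ b (t₀, 0) = 0 ∧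
      (∃ e : (ℝ × ℝ) ≃L[ℝ] ℝ × ℝ,
        HasFDerivAt (fun z => (a z, b z)) (e : (ℝ × ℝ) →L[ℝ] ℝ × ℝ) (t₀, 0)) ∧
      ∀ᶠ z : ℝ × ℝ in 𝓝 (t₀, 0), a z + b z = x z.1 + r z * deriv x z.1 ∧
        a z ^ 2 + 2 * b z * a z =
          y z.1 + r z * deriv y z.1 + H (x z.1 + r z * deriv x z.1) := by
  obtain ⟨h, hh, hhx⟩ := hx.exists_graph hy hx1
  rw [hx0] at hh
  have hh0 : h 0 = 0 := by simpa [hx0, hy0] using hhx.self_of_nhds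
  have hhx' : ∀ᶠ t in 𝓝 t₀, deriv h (x t) * deriv x t = deriv y t := by
    have h1 : ∀ᶠ t in 𝓝 t₀, ContDiffAt ℝ ∞ h (x t) :=
      hx.contDiffAt.continuousAt.eventually (by rwa [hx0])
    filter_upwards [h1, hx, eventually_eventually_nhds.2 hhx] with t h1 h2 h3
    have := HasDerivAt.comp t (h1.differentiableAt (by simp)).hasDerivAt
      (h2.differentiableAt (by simp)).hasDerivAt
    rw [← this.deriv]
    exact Filter.EventuallyEq.deriv_eq h3
  have hd0 : deriv h 0 = 0 := by
    have := hhx'.self_of_nhds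
    rwa [hx0, hx1, hy1, mul_one] at this
  have hdd0 : deriv (deriv h) 0 = 1 := by
    have h1 : DifferentiableAt ℝ (deriv h) (x t₀) := by
      rw [hx0]
      exact hh.deriv.differentiableAt
    -- Differentiate `h'(x) x' = y'`. The unknown `x''` drops out because `h'(0) = 0`.
    have h2 := (HasDerivAt.comp t₀ h1.hasDerivAt hx.differentiableAt.hasDerivAt).mul
      hx.deriv.differentiableAt.hasDerivAt
    have h3 : HasDerivAt (deriv y) _ t₀ := h2.congr_of_eventuallyEq
      (hhx'.mono fun t ht => ht.symm)
    have h4 := h3.deriv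
    simp only [Function.comp, hx0, hx1, hy2, hd0] at h4
    linarith
  obtain ⟨k, hk, hk0, hkT⟩ := hh.exists_taylor_two
  rw [hdd0] at hk0
  -- The remainder `R² k` becomes the square of `b = R κ`; the root is smooth because `k (0, 0) =
  -- 1/2`.
  set κ : ℝ × ℝ → ℝ := fun z => √(k z) with hκ
  have hκs : SmoothNear κ (0, 0) := by
    filter_upwards [hk, hk.contDiffAt.continuousAt.eventually
      (isOpen_ne.mem_nhds (by rw [hk0]; norm_num : k (0, 0) ≠ 0))] with z h1 h2
    exact h1.sqrt h2
  have hκ0 : 0 < κ (0, 0) := by simp [hκ, hk0]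
  have hκk : ∀ᶠ z in 𝓝 ((0, 0) : ℝ × ℝ), κ z ^ 2 = k z := by
    filter_upwards [hk.contDiffAt.continuousAt.eventually
      (lt_mem_nhds (by rw [hk0]; norm_num : 0 < k (0, 0)))] with z h1
    exact Real.sq_sqrt h1.le
  have hfst : SmoothNear (Prod.fst : ℝ × ℝ → ℝ) (t₀, 0) := .of_contDiff contDiff_fst
  set T : ℝ × ℝ → ℝ := fun z => x z.1 with hT
  set R : ℝ × ℝ → ℝ := fun z => r z * deriv x z.1 with hR
  have hTs : SmoothNear T (t₀, 0) := SmoothNear.comp (g := x) (t₀, (0 : ℝ)) hx hfst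
  have hxs : SmoothNear (fun z : ℝ × ℝ => deriv x z.1) (t₀, 0) :=
    SmoothNear.comp (g := deriv x) (t₀, (0 : ℝ)) hx.deriv hfst
  have hRs : SmoothNear R (t₀, 0) := hr.mul hxs
  have hr00 : r (t₀, 0) = 0 := hr0.self_of_nhds
  have hT0 : T (t₀, 0) = 0 := hx0
  have hR0 : R (t₀, 0) = 0 := by simp [hR, hr00]
  have hTR : SmoothNear (fun z => κ (T z, R z)) (t₀, 0) :=
    SmoothNear.comp (g := κ) (t₀, (0 : ℝ)) (by rwa [hT0, hR0]) (hTs.prodMk hRs)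
  set b : ℝ × ℝ → ℝ := fun z => R z * κ (T z, R z) with hb
  have hbs : SmoothNear b (t₀, 0) := hRs.mul hTR
  have hb0 : b (t₀, 0) = 0 := by simp [hb, hR0]
  have hTd : HasFDerivAt T (ContinuousLinearMap.fst ℝ ℝ ℝ) (t₀, 0) := by
    have h1 : HasDerivAt x 1 t₀ := hx1 ▸ hx.differentiableAt.hasDerivAt
    have h2 : HasFDerivAt (Prod.fst : ℝ × ℝ → ℝ) (ContinuousLinearMap.fst ℝ ℝ ℝ) (t₀, 0) :=
      hasFDerivAt_fst
    have := HasFDerivAt.comp (g := x) ((t₀, 0) : ℝ × ℝ) h1.hasFDerivAt h2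
    refine this.congr_fderiv ?_
    ext <;> simp
  have hRd : HasFDerivAt R (ContinuousLinearMap.snd ℝ ℝ ℝ) (t₀, 0) := by
    have h1 := hasFDerivAt_of_vanishing_on_axis hr.differentiableAt hr0 hr1
    have := h1.mul hxs.differentiableAt.hasFDerivAt
    refine this.congr_fderiv ?_
    ext <;> simp [hr00, hx1]
  have hbd : HasFDerivAt b (κ (0, 0) • ContinuousLinearMap.snd ℝ ℝ ℝ) (t₀, 0) := by
    have := hRd.mul hTR.differentiableAt.hasFDerivAt
    refine this.congr_fderiv ?_
    ext <;> simp [hR0, hT0]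
  -- With `X = T + R = a + b`, the height is `h X - b²`; adding `X² - h X` leaves `(a + b)² - b² =
  -- a² + 2ab`.
  refine ⟨fun X => X ^ 2 - h X, fun z => T z + R z - b z, b, ?_, by simp [hh0], ?_, hbs,
    by simp [hT0, hR0, hb0], hb0, ?_, ?_⟩
  · exact (SmoothNear.of_contDiff (by fun_prop)).sub hh
  · exact (hTs.add hRs).sub hbs
  · set c := κ (0, 0) with hc
    refine ⟨ContinuousLinearEquiv.equivOfInverse
      ((ContinuousLinearMap.fst ℝ ℝ ℝ + ContinuousLinearMap.snd ℝ ℝ ℝ -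
        c • ContinuousLinearMap.snd ℝ ℝ ℝ).prod (c • ContinuousLinearMap.snd ℝ ℝ ℝ))
      ((ContinuousLinearMap.fst ℝ ℝ ℝ + ContinuousLinearMap.snd ℝ ℝ ℝ -
        c⁻¹ • ContinuousLinearMap.snd ℝ ℝ ℝ).prod (c⁻¹ • ContinuousLinearMap.snd ℝ ℝ ℝ))
      ?_ ?_, ?_⟩
    · rintro ⟨p, s⟩
      ext
      · simp [hκ0.ne']
      · simp [hκ0.ne']
    · rintro ⟨p, s⟩
      ext
      · simp [hκ0.ne']
      · simp [hκ0.ne']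
    · exact ((hTd.add hRd).sub hbd).prodMk hbd
  · have hlim : Tendsto (fun z => (T z, R z)) (𝓝 (t₀, 0)) (𝓝 (0, 0)) := by
      have := (hTs.prodMk hRs).contDiffAt.continuousAt.tendsto
      rwa [hT0, hR0] at this
    have hfl : Tendsto (Prod.fst : ℝ × ℝ → ℝ) (𝓝 (t₀, 0)) (𝓝 t₀) :=
      continuous_fst.continuousAt
    filter_upwards [hlim.eventually hκk, hlim.eventually hkT, hfl.eventually hhx,
      hfl.eventually hhx'] with z h1 h2 h3 h4
    refine ⟨by ring, ?_⟩
    rw [← h1] at h2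
    have h5 : R z * deriv h (T z) = r z * deriv y z.1 := by
      rw [← h4]
      simp only [hR, hT]
      ring
    rw [h5, show h (T z) = y z.1 from h3] at h2
    have h6 : x z.1 + r z * deriv x z.1 = T z + R z := rfl
    rw [h6]
    simp only [hb]
    linear_combination -h2

end FoldNormalForm

end

noncomputable section

/-! ### Geodesics in coordinates: existence, uniqueness, `geodesicMap`. -/

section GeodesicCoordinates

variable {m : ℕ} {M : Type*} [TopologicalSpace M] [ChartedSpace (EuclideanSpace ℝ (Fin m)) M]

local notation "𝔼" => EuclideanSpace ℝ (Fin m)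

lemma contDiffAt_christoffelForm {E : Type*} [NormedAddCommGroup E] [NormedSpace ℝ E]
    {G : Fin m → Fin m → 𝔼 → 𝔼} {y u w : E → 𝔼} {z : E}
    (hG : ∀ i j, ContDiffAt ℝ ∞ (G i j) (y z)) (hy : ContDiffAt ℝ ∞ y z)
    (hu : ContDiffAt ℝ ∞ u z) (hw : ContDiffAt ℝ ∞ w z) :
    ContDiffAt ℝ ∞ (fun z => christoffelForm G (y z) (u z) (w z)) z := by
  unfold christoffelForm
  refine ContDiffAt.sum fun i _ => ContDiffAt.sum fun j _ => ?_
  have h1 : ContDiffAt ℝ ∞ (fun z => u z i) z :=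
    (EuclideanSpace.proj i : 𝔼 →L[ℝ] ℝ).contDiff.contDiffAt.comp z hu
  have h2 : ContDiffAt ℝ ∞ (fun z => w z j) z :=
    (EuclideanSpace.proj j : 𝔼 →L[ℝ] ℝ).contDiff.contDiffAt.comp z hw
  exact (h1.mul h2).smul ((hG i j).comp z hy)

/-- The geodesic spray in coordinates. -/
def spray (G : Fin m → Fin m → 𝔼 → 𝔼) (p : 𝔼 × 𝔼) : 𝔼 × 𝔼 :=
  (p.2, -christoffelForm G p.1 p.2 p.2)

lemma contDiffAt_spray {G : Fin m → Fin m → 𝔼 → 𝔼} {p : 𝔼 × 𝔼}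
    (hG : ∀ i j, ContDiffAt ℝ ∞ (G i j) p.1) :
    ContDiffAt ℝ ∞ (spray G) p := by
  exact contDiffAt_snd.prodMk
    (contDiffAt_christoffelForm hG contDiffAt_fst contDiffAt_snd contDiffAt_snd).neg

lemma christoffelForm_smul_smul {G : Fin m → Fin m → 𝔼 → 𝔼} (y u : 𝔼) (a b : ℝ) (w : 𝔼) :
    christoffelForm G y (a • u) (b • w) = (a * b) • christoffelForm G y u w := by
  simp only [christoffelForm, Finset.smul_sum, smul_smul, PiLp.smul_apply, smul_eq_mul]
  refine Finset.sum_congr rfl fun i _ => Finset.sum_congr rfl fun j _ => ?_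
  ring_nf

lemma christoffelForm_add_left {G : Fin m → Fin m → 𝔼 → 𝔼} (y u v w : 𝔼) :
    christoffelForm G y (u + v) w = christoffelForm G y u w + christoffelForm G y v w := by
  simp only [christoffelForm, ← Finset.sum_add_distrib, ← add_smul, PiLp.add_apply]
  refine Finset.sum_congr rfl fun i _ => Finset.sum_congr rfl fun j _ => ?_
  ring_nf

lemma christoffelForm_add_right {G : Fin m → Fin m → 𝔼 → 𝔼} (y u v w : 𝔼) :
    christoffelForm G y u (v + w) = christoffelForm G y u v + christoffelForm G y u w := by
  simp only [christoffelForm, ← Finset.sum_add_distrib, ← add_smul, PiLp.add_apply]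
  refine Finset.sum_congr rfl fun i _ => Finset.sum_congr rfl fun j _ => ?_
  ring_nf

lemma christoffelForm_comm {G : Fin m → Fin m → 𝔼 → 𝔼} {y : 𝔼}
    (hG : ∀ i j, G i j y = G j i y) (u w : 𝔼) :
    christoffelForm G y u w = christoffelForm G y w u := by
  unfold christoffelForm
  rw [Finset.sum_comm]
  refine Finset.sum_congr rfl fun i _ => Finset.sum_congr rfl fun j _ => ?_
  rw [hG, mul_comm]

/-- Solutions of smooth autonomous equations are smooth. -/
lemma contDiffOn_of_hasDerivAt_autonomous {E : Type*} [NormedAddCommGroup E] [NormedSpace ℝ E]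
    {X : E → E} {α : ℝ → E} {J : Set ℝ} (hJ : IsOpen J)
    (hX : ∀ s ∈ J, ContDiffAt ℝ ∞ X (α s)) (hα : ∀ s ∈ J, HasDerivAt α (X (α s)) s) :
    ContDiffOn ℝ ∞ α J := by
  refine contDiffOn_infty.2 fun n => ?_
  induction n with
  | zero => exact contDiffOn_zero.2 fun s hs => (hα s hs).continuousAt.continuousWithinAt
  | succ n ih =>
    push_cast
    rw [contDiffOn_succ_iff_deriv_of_isOpen hJ]
    refine ⟨fun s hs => (hα s hs).differentiableAt.differentiableWithinAt, by simp, ?_⟩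
    refine ContDiffOn.congr (fun s hs => ?_) fun s hs => (hα s hs).deriv
    exact (((hX s hs).of_le (by exact_mod_cast le_top)).comp_contDiffWithinAt s (ih s hs))

/-- Local existence of geodesics in coordinates. -/
lemma exists_coordinate_geodesic {G : Fin m → Fin m → 𝔼 → 𝔼} {N : Set 𝔼} (hN : IsOpen N)
    (hG : ∀ y ∈ N, ∀ i j, ContDiffAt ℝ ∞ (G i j) y) {y₀ : 𝔼} (hy₀ : y₀ ∈ N) (v : 𝔼) :
    ∃ (y y₁ : ℝ → 𝔼) (ε : ℝ), 0 < ε ∧ y 0 = y₀ ∧ y₁ 0 = v ∧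
      ContDiffOn ℝ ∞ y (Ioo (-ε) ε) ∧ ∀ s ∈ Ioo (-ε) ε, y s ∈ N ∧ HasDerivAt y (y₁ s) s ∧
        HasDerivAt y₁ (-christoffelForm G (y s) (y₁ s) (y₁ s)) s := by
  have hX : ContDiffAt ℝ 1 (spray G) (y₀, v) :=
    (contDiffAt_spray (hG y₀ hy₀)).of_le (by simp)
  obtain ⟨r, hr, ε, hε, H⟩ :=
    hX.exists_forall_mem_closedBall_exists_eq_forall_mem_Ioo_hasDerivAt 0
  obtain ⟨α, hα0, hα⟩ := H _ (Metric.mem_closedBall_self hr.le)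
  simp only [zero_sub, zero_add] at hα
  have hc : ContinuousAt (fun s => (α s).1) 0 :=
    continuous_fst.continuousAt.comp (hα 0 ⟨by linarith, hε⟩).continuousAt
  obtain ⟨δ, hδ, hδN⟩ := Metric.eventually_nhds_iff_ball.1
    (hc.eventually (hN.mem_nhds (by simpa [hα0] using hy₀)))
  have hsub : ∀ s ∈ Ioo (-min ε δ) (min ε δ), s ∈ Ioo (-ε) ε ∧ (α s).1 ∈ N := by
    intro s hs
    refine ⟨⟨?_, hs.2.trans_le (min_le_left _ _)⟩, hδN s ?_⟩
    · linarith [hs.1, min_le_left ε δ]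
    · rw [Real.ball_eq_Ioo]
      constructor <;> linarith [hs.1, hs.2, min_le_right ε δ]
  have hsm : ContDiffOn ℝ ∞ α (Ioo (-min ε δ) (min ε δ)) :=
    contDiffOn_of_hasDerivAt_autonomous isOpen_Ioo
      (fun s hs => contDiffAt_spray (hG _ (hsub s hs).2)) fun s hs => hα s (hsub s hs).1
  refine ⟨fun s => (α s).1, fun s => (α s).2, min ε δ, lt_min hε hδ, congrArg Prod.fst hα0,
    congrArg Prod.snd hα0,
    contDiff_fst.comp_contDiffOn hsm, fun s hs => ⟨(hsub s hs).2, ?_, ?_⟩⟩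
  · exact hasFDerivAt_fst.comp_hasDerivAt s (hα s (hsub s hs).1)
  · exact hasFDerivAt_snd.comp_hasDerivAt s (hα s (hsub s hs).1)

namespace PartialDiffeomorph

lemma dcoord_curveVelocity (Ψ : PartialDiffeomorph (𝓡 m) 𝓘(ℝ, 𝔼) M 𝔼 ∞) {c : ℝ → M} {s : ℝ}
    (hs : c s ∈ Ψ.source) (hc : MDifferentiableAt 𝓘(ℝ, ℝ) (𝓡 m) c s) :
    Ψ.dcoord (c s) (curveVelocity c s) = deriv (fun s => Ψ (c s)) s := by
  have h := (((Ψ.contMDiffAt hs).mdifferentiableAt (by simp)).hasMFDerivAt.comp s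
    hc.hasMFDerivAt)
  have h' : HasFDerivAt (fun s => Ψ (c s)) (show ℝ →L[ℝ] 𝔼 from
    (mfderiv (𝓡 m) 𝓘(ℝ, 𝔼) Ψ (c s)).comp (mfderiv 𝓘(ℝ, ℝ) (𝓡 m) c s)) s := h.hasFDerivAt
  exact h'.hasDerivAt.deriv.symm

lemma smoothNear_comp (Ψ : PartialDiffeomorph (𝓡 m) 𝓘(ℝ, 𝔼) M 𝔼 ∞) {c : ℝ → M} {s : ℝ}
    (hs : c s ∈ Ψ.source) (hc : ∀ᶠ τ in 𝓝 s, ContMDiffAt 𝓘(ℝ, ℝ) (𝓡 m) ∞ c τ) :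
    SmoothNear (fun s => Ψ (c s)) s := by
  filter_upwards [hc, hc.self_of_nhds.continuousAt.eventually (Ψ.open_source.mem_nhds hs)]
    with τ h1 h2
  exact ((Ψ.contMDiffAt h2).comp τ h1).contDiffAt

lemma eventually_dcoord_curveVelocity (Ψ : PartialDiffeomorph (𝓡 m) 𝓘(ℝ, 𝔼) M 𝔼 ∞) {c : ℝ → M}
    {s : ℝ} (hs : c s ∈ Ψ.source) (hc : ∀ᶠ τ in 𝓝 s, ContMDiffAt 𝓘(ℝ, ℝ) (𝓡 m) ∞ c τ) :
    ∀ᶠ τ in 𝓝 s, Ψ.dcoord (c τ) (curveVelocity c τ) = deriv (fun s => Ψ (c s)) τ := by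
  filter_upwards [hc, hc.self_of_nhds.continuousAt.eventually (Ψ.open_source.mem_nhds hs)]
    with τ h1 h2
  exact Ψ.dcoord_curveVelocity h2 (h1.mdifferentiableAt (by simp))

variable [IsManifold (𝓡 m) ∞ M]

/-- The acceleration of a curve in coordinates. -/
lemma dcoord_covDerivAlong_curveVelocity (Ψ : PartialDiffeomorph (𝓡 m) 𝓘(ℝ, 𝔼) M 𝔼 ∞)
    (cov : CovariantDerivative (𝓡 m) 𝔼 (TangentSpace (𝓡 m) : M → Type _)) {c : ℝ → M}
    {s : ℝ} (hs : c s ∈ Ψ.source) (hc : ∀ᶠ τ in 𝓝 s, ContMDiffAt 𝓘(ℝ, ℝ) (𝓡 m) ∞ c τ) :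
    Ψ.dcoord (c s) (covDerivAlong cov c (curveVelocity c) s) =
      deriv (deriv fun s => Ψ (c s)) s + christoffelForm (Ψ.christoffel cov) (Ψ (c s))
        (deriv (fun s => Ψ (c s)) s) (deriv (fun s => Ψ (c s)) s) := by
  have hev := Ψ.eventually_dcoord_curveVelocity hs hc
  rw [Ψ.dcoord_covDerivAlong cov hs (hc.self_of_nhds.mdifferentiableAt (by simp)) _
    (Ψ.smoothNear_comp hs hc).deriv.differentiableAt hev, hev.self_of_nhds]

/-- In coordinates the geodesic equation is `y'' = -Γ(y', y')`, and injectivity of `dcoord` carries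
it back to `M`. -/
lemma isGeodesicCurveOn_symm_comp (Ψ : PartialDiffeomorph (𝓡 m) 𝓘(ℝ, 𝔼) M 𝔼 ∞)
    (cov : CovariantDerivative (𝓡 m) 𝔼 (TangentSpace (𝓡 m) : M → Type _)) {y y₁ : ℝ → 𝔼}
    {J : Set ℝ} (hJ : IsOpen J) (hy : ContDiffOn ℝ ∞ y J) (hyJ : ∀ s ∈ J, y s ∈ Ψ.target)
    (hy₁ : ∀ s ∈ J, HasDerivAt y (y₁ s) s) (hy₂ : ∀ s ∈ J, HasDerivAt y₁
      (-christoffelForm (Ψ.christoffel cov) (y s) (y₁ s) (y₁ s)) s) :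
    IsGeodesicCurveOn cov (fun s => Ψ.symm (y s)) J := by
  have hsm : ContMDiffOn 𝓘(ℝ, ℝ) (𝓡 m) ∞ (fun s => Ψ.symm (y s)) J :=
    Ψ.symm.contMDiffOn.comp hy.contMDiffOn hyJ
  refine ⟨hsm, fun s hs => ?_⟩
  have hsrc : Ψ.symm (y s) ∈ Ψ.source := Ψ.map_target (hyJ s hs)
  have hev : ∀ᶠ τ in 𝓝 s, ContMDiffAt 𝓘(ℝ, ℝ) (𝓡 m) ∞ (fun s => Ψ.symm (y s)) τ := by
    filter_upwards [hJ.mem_nhds hs] with τ hτ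
    exact (hsm τ hτ).contMDiffAt (hJ.mem_nhds hτ)
  have hinv : ∀ τ ∈ J, Ψ (Ψ.symm (y τ)) = y τ := fun τ hτ => Ψ.right_inv (hyJ τ hτ)
  have hd : ∀ τ ∈ J, deriv (fun s => Ψ (Ψ.symm (y s))) τ = y₁ τ := by
    intro τ hτ
    refine ((hy₁ τ hτ).congr_of_eventuallyEq ?_).deriv
    filter_upwards [hJ.mem_nhds hτ] with τ' hτ' using hinv τ' hτ'
  have hdd : deriv (deriv fun s => Ψ (Ψ.symm (y s))) s =
      -christoffelForm (Ψ.christoffel cov) (y s) (y₁ s) (y₁ s) := by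
    refine ((hy₂ s hs).congr_of_eventuallyEq ?_).deriv
    filter_upwards [hJ.mem_nhds hs] with τ hτ using hd τ hτ
  apply Ψ.dcoord_injective hsrc
  rw [map_zero]
  refine (Ψ.dcoord_covDerivAlong_curveVelocity cov (c := fun s => Ψ.symm (y s)) hsrc hev).trans ?_
  rw [hdd, hinv s hs, hd s hs, neg_add_cancel]

/-- Local uniqueness of geodesics. -/
lemma eventuallyEq_of_geodesic (Ψ : PartialDiffeomorph (𝓡 m) 𝓘(ℝ, 𝔼) M 𝔼 ∞)
    (cov : CovariantDerivative (𝓡 m) 𝔼 (TangentSpace (𝓡 m) : M → Type _))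
    (hG : ∀ y ∈ Ψ.target, ∀ i j, ContDiffAt ℝ ∞ (Ψ.christoffel cov i j) y)
    {c₁ c₂ : ℝ → M} {J₁ J₂ : Set ℝ} (hJ₁ : IsOpen J₁) (hJ₂ : IsOpen J₂)
    (h₁ : IsGeodesicCurveOn cov c₁ J₁) (h₂ : IsGeodesicCurveOn cov c₂ J₂) {s : ℝ}
    (hs₁ : s ∈ J₁) (hs₂ : s ∈ J₂) (hsrc : c₂ s ∈ Ψ.source) (heq : c₁ s = c₂ s)
    (hvel : deriv (fun s => Ψ (c₁ s)) s = deriv (fun s => Ψ (c₂ s)) s) : c₁ =ᶠ[𝓝 s] c₂ := by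
  -- Position and velocity in coordinates form an integral curve of the spray, which is locally
  -- Lipschitz.
  have key : ∀ {c : ℝ → M} {J : Set ℝ}, IsOpen J → IsGeodesicCurveOn cov c J → s ∈ J →
      c s ∈ Ψ.source → ContinuousAt (fun τ => (Ψ (c τ), deriv (fun s => Ψ (c s)) τ)) s ∧
      ∀ᶠ τ in 𝓝 s, c τ ∈ Ψ.source ∧ HasDerivAt (fun τ => (Ψ (c τ), deriv (fun s => Ψ (c s)) τ))
        (spray (Ψ.christoffel cov) (Ψ (c τ), deriv (fun s => Ψ (c s)) τ)) τ := by
    intro c J hJ hc hs hsrc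
    have hev : ∀ τ ∈ J, ∀ᶠ τ' in 𝓝 τ, ContMDiffAt 𝓘(ℝ, ℝ) (𝓡 m) ∞ c τ' := by
      intro τ hτ
      filter_upwards [hJ.mem_nhds hτ] with τ' hτ'
      exact (hc.smooth τ' hτ').contMDiffAt (hJ.mem_nhds hτ')
    have hd : ∀ τ ∈ J, c τ ∈ Ψ.source →
        HasDerivAt (fun τ => (Ψ (c τ), deriv (fun s => Ψ (c s)) τ))
          (spray (Ψ.christoffel cov) (Ψ (c τ), deriv (fun s => Ψ (c s)) τ)) τ := by
      intro τ hτ hτs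
      have hg := Ψ.smoothNear_comp hτs (hev τ hτ)
      have h := Ψ.dcoord_covDerivAlong_curveVelocity cov hτs (hev τ hτ)
      rw [hc.geodesic τ hτ, map_zero] at h
      have hdd := hg.deriv.differentiableAt.hasDerivAt
      rw [eq_neg_of_add_eq_zero_left h.symm] at hdd
      exact hg.differentiableAt.hasDerivAt.prodMk hdd
    refine ⟨(hd s hs hsrc).continuousAt, ?_⟩
    filter_upwards [hJ.mem_nhds hs,
      (hev s hs).self_of_nhds.continuousAt.eventually (Ψ.open_source.mem_nhds hsrc)] with τ h1 h2
    exact ⟨h2, hd τ h1 h2⟩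
  obtain ⟨k₁, e₁⟩ := key hJ₁ h₁ hs₁ (heq ▸ hsrc)
  obtain ⟨k₂, e₂⟩ := key hJ₂ h₂ hs₂ hsrc
  have hsp : ContDiffAt ℝ 1 (spray (Ψ.christoffel cov))
      (Ψ (c₂ s), deriv (fun s => Ψ (c₂ s)) s) :=
    (contDiffAt_spray (hG _ (Ψ.map_source hsrc))).of_le (by simp)
  obtain ⟨K, S, hS, hlip⟩ := hsp.exists_lipschitzOnWith
  have heq0 : (Ψ (c₁ s), deriv (fun s => Ψ (c₁ s)) s) =
      (Ψ (c₂ s), deriv (fun s => Ψ (c₂ s)) s) := by rw [heq, hvel]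
  have hS₁ : ∀ᶠ τ in 𝓝 s, (Ψ (c₁ τ), deriv (fun s => Ψ (c₁ s)) τ) ∈ S :=
    k₁.eventually (by beta_reduce; rw [heq0]; exact hS)
  have hS₂ : ∀ᶠ τ in 𝓝 s, (Ψ (c₂ τ), deriv (fun s => Ψ (c₂ s)) τ) ∈ S := k₂.eventually hS
  have huniq := ODE_solution_unique_of_eventually (v := fun _ => spray (Ψ.christoffel cov))
    (s := fun _ => S) (.of_forall fun _ => hlip) ((e₁.and hS₁).mono fun τ h => ⟨h.1.2, h.2⟩)
    ((e₂.and hS₂).mono fun τ h => ⟨h.1.2, h.2⟩) heq0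
  filter_upwards [huniq, e₁, e₂] with τ h1 h2 h3
  exact Ψ.injOn h2.1 h3.1 (congrArg Prod.fst h1)

/-- A geodesic inside the domain of a coordinate system agrees with every geodesic with the same
initial condition. -/
lemma eqOn_of_isGeodesicFrom [T2Space M] (Ψ : PartialDiffeomorph (𝓡 m) 𝓘(ℝ, 𝔼) M 𝔼 ∞)
    (cov : CovariantDerivative (𝓡 m) 𝔼 (TangentSpace (𝓡 m) : M → Type _))
    (hG : ∀ y ∈ Ψ.target, ∀ i j, ContDiffAt ℝ ∞ (Ψ.christoffel cov i j) y)
    {p : TangentBundle (𝓡 m) M} {c₁ c₂ : ℝ → M} {J₁ J₂ : Set ℝ}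
    (h₁ : IsGeodesicFrom cov p c₁ J₁) (h₂ : IsGeodesicFrom cov p c₂ J₂)
    (hsrc : ∀ s ∈ J₂, c₂ s ∈ Ψ.source) : EqOn c₁ c₂ (J₁ ∩ J₂) := by
  have hcont : ∀ {c : ℝ → M} {J : Set ℝ}, IsGeodesicFrom cov p c J → ∀ s ∈ J,
      ∀ᶠ τ in 𝓝 s, ContMDiffAt 𝓘(ℝ, ℝ) (𝓡 m) ∞ c τ := by
    intro c J h s hs
    filter_upwards [h.isOpen.mem_nhds hs] with τ hτ
    exact (h.isGeodesic.smooth τ hτ).contMDiffAt (h.isOpen.mem_nhds hτ)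
  have hpre : IsPreconnected (J₁ ∩ J₂) := (h₁.ordConnected.inter h₂.ordConnected).isPreconnected
  -- The set of local agreement is open. It is relatively closed because agreement of positions (`M`
  -- is Hausdorff) and of velocities passes to limits, where local uniqueness applies again.
  have hsub : J₁ ∩ J₂ ⊆ {s | c₁ =ᶠ[𝓝 s] c₂} := by
    refine hpre.subset_of_closure_inter_subset isOpen_setOfPred_eventually_nhds ?_ ?_
    · refine ⟨0, ⟨h₁.zero_mem, h₂.zero_mem⟩, ?_⟩
      have hp := h₁.initial.trans h₂.initial.symm
      have heq : c₁ 0 = c₂ 0 := congrArg Bundle.TotalSpace.proj hp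
      have hs₂ := hsrc 0 h₂.zero_mem
      refine Ψ.eventuallyEq_of_geodesic cov hG h₁.isOpen h₂.isOpen h₁.isGeodesic h₂.isGeodesic
        h₁.zero_mem h₂.zero_mem hs₂ heq ?_
      rw [← Ψ.dcoord_curveVelocity (heq ▸ hs₂)
          ((hcont h₁ 0 h₁.zero_mem).self_of_nhds.mdifferentiableAt (by simp)),
        ← Ψ.dcoord_curveVelocity hs₂
          ((hcont h₂ 0 h₂.zero_mem).self_of_nhds.mdifferentiableAt (by simp))]
      exact congrArg (fun p : TangentBundle (𝓡 m) M => Ψ.dcoord p.1 p.2) hp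
    · rintro s ⟨hcl, hs₁, hs₂⟩
      have hfr : ∃ᶠ τ in 𝓝 s, c₁ =ᶠ[𝓝 τ] c₂ := mem_closure_iff_frequently.1 hcl
      have heq : c₁ s = c₂ s := tendsto_nhds_unique_of_frequently_eq
        (hcont h₁ s hs₁).self_of_nhds.continuousAt (hcont h₂ s hs₂).self_of_nhds.continuousAt
        (hfr.mono fun τ h => h.eq_of_nhds)
      refine Ψ.eventuallyEq_of_geodesic cov hG h₁.isOpen h₂.isOpen h₁.isGeodesic h₂.isGeodesic
        hs₁ hs₂ (hsrc s hs₂) heq ?_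
      refine tendsto_nhds_unique_of_frequently_eq
        (Ψ.smoothNear_comp (heq ▸ hsrc s hs₂) (hcont h₁ s hs₁)).deriv.contDiffAt.continuousAt
        (Ψ.smoothNear_comp (hsrc s hs₂) (hcont h₂ s hs₂)).deriv.contDiffAt.continuousAt
        (hfr.mono fun τ h => ?_)
      exact Filter.EventuallyEq.deriv_eq (h.fun_comp Ψ)
  intro s hs
  exact (hsub hs).eq_of_nhds

/-- `geodesicMap` chooses some geodesic; uniqueness makes the choice immaterial. -/
lemma geodesicMap_eq [T2Space M] (Ψ : PartialDiffeomorph (𝓡 m) 𝓘(ℝ, 𝔼) M 𝔼 ∞)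
    (cov : CovariantDerivative (𝓡 m) 𝔼 (TangentSpace (𝓡 m) : M → Type _))
    (hG : ∀ y ∈ Ψ.target, ∀ i j, ContDiffAt ℝ ∞ (Ψ.christoffel cov i j) y)
    {p : TangentBundle (𝓡 m) M} {c : ℝ → M} {J : Set ℝ} (h : IsGeodesicFrom cov p c J)
    (hsrc : ∀ s ∈ J, c s ∈ Ψ.source) {s : ℝ} (hs : s ∈ J) : geodesicMap cov p s = c s := by
  have hex : ∃ c : ℝ → M, ∃ J : Set ℝ, IsGeodesicFrom cov p c J ∧ s ∈ J := ⟨c, J, h, hs⟩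
  rw [geodesicMap, dif_pos hex]
  obtain ⟨J', hJ', hsJ'⟩ := hex.choose_spec
  exact Ψ.eqOn_of_isGeodesicFrom cov hG hJ' h hsrc ⟨hsJ', hs⟩

end PartialDiffeomorph

end GeodesicCoordinates

end

noncomputable section

/-! ### Projective flatness as a condition on the Christoffel symbols. -/

section Flatness

variable {m : ℕ} {M : Type*} [TopologicalSpace M] [ChartedSpace (EuclideanSpace ℝ (Fin m)) M]

local notation "𝔼" => EuclideanSpace ℝ (Fin m)

/-- A curve contained in a line has its velocity and acceleration tangent to the line. -/
lemma exists_deriv_eq_smul_of_mem_line {y y₁ : ℝ → 𝔼} {w a b : 𝔼} {J : Set ℝ} (hJ : IsOpen J)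
    {s : ℝ} (hs : s ∈ J) (hy : ∀ s ∈ J, HasDerivAt y (y₁ s) s) (hy₁ : HasDerivAt y₁ w s)
    (hline : ∀ s ∈ J, ∃ r : ℝ, y s = a + r • b) (hne : y₁ s ≠ 0) : ∃ l : ℝ, w = l • y₁ s := by
  -- `P` is a multiple of the projection orthogonal to `b`, so it is constant along the line and
  -- annihilates both derivatives. For `b ≠ 0` its kernel is the line spanned by `b`.
  set P : 𝔼 →L[ℝ] 𝔼 := (inner ℝ b b) • ContinuousLinearMap.id ℝ 𝔼 - (innerSL ℝ b).smulRight b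
    with hP
  have hPapp : ∀ z, P z = (inner ℝ b b : ℝ) • z - (inner ℝ b z : ℝ) • b := fun z => by simp [hP]
  have hPy : ∀ s ∈ J, P (y s) = P a := by
    intro s hs
    obtain ⟨r, hr⟩ := hline s hs
    have hPb : P b = 0 := by rw [hPapp, sub_self]
    rw [hr, map_add, map_smul, hPb, smul_zero, add_zero]
  have hPy₁ : ∀ s ∈ J, P (y₁ s) = 0 := by
    intro s hs
    have h1 : HasDerivAt (fun s => P (y s)) (P (y₁ s)) s :=
      P.hasFDerivAt.comp_hasDerivAt s (hy s hs)
    refine h1.unique ((hasDerivAt_const s (P a)).congr_of_eventuallyEq ?_)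
    filter_upwards [hJ.mem_nhds hs] with τ hτ using hPy τ hτ
  have hPw : P w = 0 := by
    have h1 : HasDerivAt (fun s => P (y₁ s)) (P w) s := P.hasFDerivAt.comp_hasDerivAt s hy₁
    refine h1.unique ((hasDerivAt_const s (0 : 𝔼)).congr_of_eventuallyEq ?_)
    filter_upwards [hJ.mem_nhds hs] with τ hτ using hPy₁ τ hτ
  have hb : b ≠ 0 := by
    rintro rfl
    apply hne
    have h1 : HasDerivAt y 0 s := by
      refine (hasDerivAt_const s a).congr_of_eventuallyEq ?_
      filter_upwards [hJ.mem_nhds hs] with τ hτ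
      obtain ⟨r, hr⟩ := hline τ hτ
      simpa using hr
    exact (hy s hs).unique h1
  have hbb : (inner ℝ b b : ℝ) ≠ 0 := inner_self_ne_zero.2 hb
  have h1 := hPy₁ s hs
  rw [hPapp, sub_eq_zero] at h1 hPw
  have hv : (inner ℝ b (y₁ s) : ℝ) ≠ 0 := by
    intro h
    rw [h, zero_smul] at h1
    exact hne ((smul_eq_zero.1 h1).resolve_left hbb)
  obtain ⟨p, hp⟩ : ∃ p : ℝ, b = p • y₁ s := by
    refine ⟨(inner ℝ b b : ℝ) / inner ℝ b (y₁ s), ?_⟩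
    rw [div_eq_inv_mul, mul_smul, h1, smul_smul, inv_mul_cancel₀ hv, one_smul]
  obtain ⟨q, hq⟩ : ∃ q : ℝ, w = q • b := by
    refine ⟨(inner ℝ b w : ℝ) / inner ℝ b b, ?_⟩
    rw [div_eq_inv_mul, mul_smul, ← hPw, smul_smul, inv_mul_cancel₀ hbb, one_smul]
  exact ⟨q * p, by rw [mul_smul, ← hp, hq]⟩

/-- Polarization: expanding `Γ(u + w, u + w)` by symmetry gives `2 Γ(u, w) = (l₃ - l₁) u + (l₃ - l₂)
w`. -/
lemma exists_christoffelForm_eq_add {G : Fin m → Fin m → 𝔼 → 𝔼} {y : 𝔼}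
    (hG : ∀ i j, G i j y = G j i y)
    (hpar : ∀ v, ∃ l : ℝ, christoffelForm G y v v = l • v) (u w : 𝔼) :
    ∃ a b : ℝ, christoffelForm G y u w = a • u + b • w := by
  obtain ⟨l₁, h₁⟩ := hpar u
  obtain ⟨l₂, h₂⟩ := hpar w
  obtain ⟨l₃, h₃⟩ := hpar (u + w)
  rw [christoffelForm_add_left, christoffelForm_add_right, christoffelForm_add_right, h₁, h₂,
    christoffelForm_comm hG w u] at h₃
  refine ⟨(l₃ - l₁) / 2, (l₃ - l₂) / 2, ?_⟩
  have h4 : (2 : ℝ) • christoffelForm G y u w = (l₃ - l₁) • u + (l₃ - l₂) • w := by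
    rw [sub_smul, sub_smul]
    have : l₃ • u + l₃ • w = l₃ • (u + w) := (smul_add _ _ _).symm
    rw [← sub_eq_zero] at h₃ ⊢
    rw [← h₃]
    module
  rw [div_eq_inv_mul, div_eq_inv_mul, mul_smul, mul_smul, ← smul_add, ← h4, smul_smul]
  norm_num

lemma PartialDiffeomorph.exists_restrict (Ψ : PartialDiffeomorph (𝓡 m) 𝓘(ℝ, 𝔼) M 𝔼 ∞)
    {S : Set M} (hS : IsOpen S) :
    ∃ Ψ' : PartialDiffeomorph (𝓡 m) 𝓘(ℝ, 𝔼) M 𝔼 ∞, Ψ'.source = Ψ.source ∩ S ∧ ∀ x, Ψ' x = Ψ x :=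
  ⟨{ Ψ.toOpenPartialHomeomorph.restrOpen S hS with
      contMDiffOn_toFun := Ψ.contMDiffOn_toFun.mono inter_subset_left
      contMDiffOn_invFun := Ψ.contMDiffOn_invFun.mono inter_subset_left }, rfl, fun _ => rfl⟩

variable [IsManifold (𝓡 m) ∞ M]

namespace PartialDiffeomorph

/-- If the geodesics are straight lines in the coordinates `Ψ`, then `Γ(v, v)` is a multiple
of `v`. -/
lemma exists_christoffelForm_self_eq_smul (Ψ : PartialDiffeomorph (𝓡 m) 𝓘(ℝ, 𝔼) M 𝔼 ∞)
    (cov : CovariantDerivative (𝓡 m) 𝔼 (TangentSpace (𝓡 m) : M → Type _))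
    (hG : ∀ y ∈ Ψ.target, ∀ i j, ContDiffAt ℝ ∞ (Ψ.christoffel cov i j) y)
    (hflat : ∀ (c : ℝ → M) (J : Set ℝ), IsOpen J → J.OrdConnected →
      IsGeodesicCurveOn cov c J → MapsTo c J Ψ.source →
      ∃ a b : 𝔼, ∀ s ∈ J, ∃ r : ℝ, Ψ (c s) = a + r • b) {y₀ : 𝔼} (hy₀ : y₀ ∈ Ψ.target) (v : 𝔼) :
    ∃ l : ℝ, christoffelForm (Ψ.christoffel cov) y₀ v v = l • v := by
  by_cases hv : v = 0
  · subst hv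
    refine ⟨0, ?_⟩
    have := christoffelForm_smul_smul (G := Ψ.christoffel cov) y₀ 0 0 0 0
    simpa using this
  -- Test flatness on the geodesic with initial velocity `v`: it lies on a line, so its acceleration
  -- `-Γ(v, v)` is parallel to `v`.
  obtain ⟨y, y₁, ε, hε, hy0, hy10, hsm, hy⟩ := exists_coordinate_geodesic Ψ.open_target hG hy₀ v
  have hgeo := Ψ.isGeodesicCurveOn_symm_comp cov isOpen_Ioo hsm (fun s hs => (hy s hs).1)
    (fun s hs => (hy s hs).2.1) fun s hs => (hy s hs).2.2
  obtain ⟨a, b, hab⟩ := hflat _ _ isOpen_Ioo ordConnected_Ioo hgeo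
    fun s hs => Ψ.map_target (hy s hs).1
  have h0 : (0 : ℝ) ∈ Ioo (-ε) ε := ⟨by linarith, hε⟩
  obtain ⟨l, hl⟩ := exists_deriv_eq_smul_of_mem_line isOpen_Ioo h0 (fun s hs => (hy s hs).2.1)
    (hy 0 h0).2.2 (fun s hs => by
      obtain ⟨r, hr⟩ := hab s hs
      exact ⟨r, (Ψ.right_inv (hy s hs).1).symm.trans hr⟩) (by rwa [hy10])
  rw [hy0, hy10] at hl
  exact ⟨-l, by rw [neg_smul, ← hl, neg_neg]⟩

end PartialDiffeomorph

end Flatness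

/-! ### Linear algebra of dependent triples and independent pairs. -/

section LinearAlgebra

lemma exists_eq_add_of_dependent {V : Type*} [AddCommGroup V] [Module ℝ V] {u v w : V}
    (h₂ : LinearIndependent ℝ ![u, v]) (h₃ : ¬ LinearIndependent ℝ ![u, v, w]) :
    ∃ a b : ℝ, w = a • u + b • v := by
  obtain ⟨g, hg, i, hi⟩ := Fintype.not_linearIndependent_iff.1 h₃
  simp only [Fin.sum_univ_three, Matrix.cons_val_zero, Matrix.cons_val_one, Matrix.cons_val] at hg
  have hg2 : g 2 ≠ 0 := by
    intro h
    rw [h, zero_smul, add_zero] at hg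
    obtain ⟨h0, h1⟩ := LinearIndependent.pair_iff.1 h₂ _ _ hg
    fin_cases i <;> simp_all
  refine ⟨-(g 2)⁻¹ * g 0, -(g 2)⁻¹ * g 1, ?_⟩
  have : w = -(g 2)⁻¹ • (g 0 • u + g 1 • v) := by
    rw [eq_neg_of_add_eq_zero_left hg, smul_neg, neg_smul, neg_neg, smul_smul, inv_mul_cancel₀ hg2,
      one_smul]
  rw [this]
  module

/-- The general linear group acts transitively on linearly independent pairs. -/
lemma exists_linearEquiv_apply_eq {V : Type*} [AddCommGroup V] [Module ℝ V] [FiniteDimensional ℝ V]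
    {v v' : Fin 2 → V} (hv : LinearIndependent ℝ v) (hv' : LinearIndependent ℝ v') :
    ∃ e : V ≃ₗ[ℝ] V, ∀ i, e (v i) = v' i := by
  classical
  set b := Module.Basis.sumExtend hv with hb
  set b' := Module.Basis.sumExtend hv' with hb'
  have : Finite (Fin 2 ⊕ Module.Basis.sumExtendIndex hv) := Module.Finite.finite_basis b
  have : Finite (Fin 2 ⊕ Module.Basis.sumExtendIndex hv') := Module.Finite.finite_basis b'
  have : Finite (Module.Basis.sumExtendIndex hv) := Finite.sum_right (Fin 2)
  have : Finite (Module.Basis.sumExtendIndex hv') := Finite.sum_right (Fin 2)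
  have hcard : Nat.card (Module.Basis.sumExtendIndex hv) =
      Nat.card (Module.Basis.sumExtendIndex hv') := by
    have h1 := Module.finrank_eq_nat_card_basis b
    rw [Module.finrank_eq_nat_card_basis b', Nat.card_sum, Nat.card_sum] at h1
    omega
  obtain ⟨σ⟩ : Nonempty (Module.Basis.sumExtendIndex hv ≃ Module.Basis.sumExtendIndex hv') :=
    Finite.card_eq.1 hcard
  refine ⟨b.equiv b' (Equiv.sumCongr (Equiv.refl _) σ), fun i => ?_⟩
  have h1 : v i = b (Sum.inl i) := by simp [hb, Module.Basis.sumExtend]; rfl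
  have h2 : v' i = b' (Sum.inl i) := by simp [hb', Module.Basis.sumExtend]; rfl
  rw [h1, h2, Module.Basis.equiv_apply]
  rfl

end LinearAlgebra

end

noncomputable section

/-! ### Torsionless Euclidean curves are planar. -/

section PlaneCurve

/-- Uniqueness of the zero solution of a linear second order differential equation. -/
lemma eventuallyEq_zero_of_linear {u w a b : ℝ → ℝ} {t₀ : ℝ} (ha : ContinuousAt a t₀)
    (hb : ContinuousAt b t₀) (hu : ∀ᶠ t in 𝓝 t₀, HasDerivAt u (w t) t)
    (hw : ∀ᶠ t in 𝓝 t₀, HasDerivAt w (a t * u t + b t * w t) t) (hu0 : u t₀ = 0)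
    (hw0 : w t₀ = 0) : u =ᶠ[𝓝 t₀] 0 := by
  obtain ⟨A, hA⟩ : ∃ A, A = |a t₀| + 1 := ⟨_, rfl⟩
  obtain ⟨B, hB⟩ : ∃ B, B = |b t₀| + 1 := ⟨_, rfl⟩
  have hA0 : 0 < A := by rw [hA]; positivity
  have hB0 : 0 < B := by rw [hB]; positivity
  have hAe : ∀ᶠ t in 𝓝 t₀, |a t| < A := ha.abs.eventually_lt_const (by rw [hA]; linarith)
  have hBe : ∀ᶠ t in 𝓝 t₀, |b t| < B := hb.abs.eventually_lt_const (by rw [hB]; linarith)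
  have hlip : ∀ᶠ t in 𝓝 t₀, LipschitzOnWith (Real.toNNReal (1 + A + B))
      (fun z : ℝ × ℝ => (z.2, a t * z.1 + b t * z.2)) univ := by
    filter_upwards [hAe, hBe] with t h1 h2
    refine LipschitzOnWith.of_dist_le_mul fun p _ q _ => ?_
    rw [Real.coe_toNNReal _ (by positivity), dist_eq_norm, dist_eq_norm]
    have e1 : |p.1 - q.1| ≤ ‖p - q‖ := norm_fst_le (p - q)
    have e2 : |p.2 - q.2| ≤ ‖p - q‖ := norm_snd_le (p - q)
    have e3 : |a t * (p.1 - q.1)| ≤ A * ‖p - q‖ := by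
      rw [abs_mul]; gcongr
    have e4 : |b t * (p.2 - q.2)| ≤ B * ‖p - q‖ := by
      rw [abs_mul]; gcongr
    have e5 := norm_nonneg (p - q)
    refine norm_prod_le_iff.2 ⟨?_, ?_⟩
    · refine le_trans e2 ?_
      nlinarith
    · have : (a t * p.1 + b t * p.2) - (a t * q.1 + b t * q.2) =
          a t * (p.1 - q.1) + b t * (p.2 - q.2) := by ring
      calc |(a t * p.1 + b t * p.2) - (a t * q.1 + b t * q.2)|
          ≤ |a t * (p.1 - q.1)| + |b t * (p.2 - q.2)| := by rw [this]; exact abs_add_le _ _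
        _ ≤ _ := by linarith
  have h := ODE_solution_unique_of_eventually (f := fun t => (u t, w t)) (g := fun _ => (0, 0))
    (v := fun t z => (z.2, a t * z.1 + b t * z.2)) (s := fun _ => univ) hlip
    ((hu.and hw).mono fun t h => ⟨h.1.prodMk h.2, mem_univ _⟩)
    (.of_forall fun t => ⟨by
      simpa using (hasDerivAt_const t (0 : ℝ)).prodMk (hasDerivAt_const t (0 : ℝ)), mem_univ _⟩)
    (by simp [hu0, hw0])
  filter_upwards [h] with t ht using congrArg Prod.fst ht

variable {m : ℕ}

local notation "𝔼" => EuclideanSpace ℝ (Fin m)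

lemma HasDerivAt.euclideanSpace_apply {F : ℝ → 𝔼} {F' : 𝔼} {t : ℝ} (h : HasDerivAt F F' t)
    (i : Fin m) : HasDerivAt (fun t => F t i) (F' i) t :=
  (EuclideanSpace.proj (𝕜 := ℝ) i).hasFDerivAt.comp_hasDerivAt t h

lemma SmoothNear.euclideanSpace_apply {E : Type*} [NormedAddCommGroup E] [NormedSpace ℝ E]
    {F : E → 𝔼} {a : E} (h : SmoothNear F a) (i : Fin m) : SmoothNear (fun t => F t i) a :=
  h.mono fun _ hz => (EuclideanSpace.proj (𝕜 := ℝ) i).contDiff.contDiffAt.comp _ hz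

/-- A curve whose third derivative stays in the span of the first two lies in its osculating
plane. -/
lemma eventually_apply_eq_zero {F : ℝ → 𝔼} {t₀ : ℝ} (hF : SmoothNear F t₀) (hF0 : F t₀ = 0)
    {i₀ i₁ : Fin m} (hF1 : deriv F t₀ = EuclideanSpace.single i₀ 1)
    (hF2 : deriv (deriv F) t₀ = EuclideanSpace.single i₁ 1) (h01 : i₀ ≠ i₁)
    (hF3 : ∀ᶠ t in 𝓝 t₀, ∃ a b : ℝ,
      deriv (deriv (deriv F)) t = a • deriv F t + b • deriv (deriv F) t)
    {i : Fin m} (hi₀ : i ≠ i₀) (hi₁ : i ≠ i₁) : ∀ᶠ t in 𝓝 t₀, F t i = 0 := by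
  have hd : ∀ {G : ℝ → 𝔼}, SmoothNear G t₀ → ∀ i, ∀ᶠ t in 𝓝 t₀,
      HasDerivAt (fun t => G t i) (deriv G t i) t := fun hG i =>
    hG.mono fun t ht => (ht.differentiableAt (by simp)).hasDerivAt.euclideanSpace_apply i
  have hc : ∀ {G G' : ℝ → 𝔼}, SmoothNear G t₀ → SmoothNear G' t₀ →
      ContinuousAt (fun t => G t i₀ * G' t i₁ - G t i₁ * G' t i₀) t₀ := fun hG hG' =>
    (((hG.euclideanSpace_apply i₀).mul (hG'.euclideanSpace_apply i₁)).sub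
      ((hG.euclideanSpace_apply i₁).mul (hG'.euclideanSpace_apply i₀))).contDiffAt.continuousAt
  have k1 := hF.deriv
  have k2 := k1.deriv
  have k3 := k2.deriv
  set D : ℝ → ℝ := fun t => deriv F t i₀ * deriv (deriv F) t i₁ -
    deriv F t i₁ * deriv (deriv F) t i₀ with hD
  have hDc : ContinuousAt D t₀ := hc k1 k2
  have hD0 : D t₀ = 1 := by simp [hD, hF1, hF2, h01, h01.symm]
  have hDne : ∀ᶠ t in 𝓝 t₀, D t ≠ 0 := hDc.eventually_ne (by rw [hD0]; exact one_ne_zero)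
  have hDt : D t₀ ≠ 0 := hDne.self_of_nhds
  -- The coefficients in `hF3` exist only pointwise. Cramer's rule in the coordinates `i₀`, `i₁`
  -- shows that they are continuous, so `F' i` solves a linear second order equation with zero
  -- initial data.
  set a : ℝ → ℝ := fun t => (deriv (deriv (deriv F)) t i₀ * deriv (deriv F) t i₁ -
    deriv (deriv (deriv F)) t i₁ * deriv (deriv F) t i₀) / D t with ha
  set b : ℝ → ℝ := fun t => (deriv F t i₀ * deriv (deriv (deriv F)) t i₁ -
    deriv F t i₁ * deriv (deriv (deriv F)) t i₀) / D t with hb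
  have hac : ContinuousAt a t₀ := (hc k3 k2).div hDc hDt
  have hbc : ContinuousAt b t₀ := (hc k1 k3).div hDc hDt
  have hw : ∀ᶠ t in 𝓝 t₀, HasDerivAt (fun t => deriv (deriv F) t i)
      (a t * deriv F t i + b t * deriv (deriv F) t i) t := by
    filter_upwards [hd k2 i, hF3, hDne] with t h1 h2 h3
    obtain ⟨p, q, h2⟩ := h2
    convert h1 using 1
    have ea : a t = p := by
      rw [ha]; beta_reduce
      rw [div_eq_iff h3, h2, hD]
      simp only [PiLp.add_apply, PiLp.smul_apply, smul_eq_mul]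
      ring
    have eb : b t = q := by
      rw [hb]; beta_reduce
      rw [div_eq_iff h3, h2, hD]
      simp only [PiLp.add_apply, PiLp.smul_apply, smul_eq_mul]
      ring
    rw [ea, eb, h2]
    simp
  have h1 : (fun t => deriv F t i) =ᶠ[𝓝 t₀] 0 :=
    eventuallyEq_zero_of_linear hac hbc (hd k1 i) hw (by simp [hF1, hi₀]) (by simp [hF2, hi₁])
  have h2 := eventuallyEq_zero_of_linear (u := fun t => F t i) (w := fun _ => 0)
    (a := fun _ => 0) (b := fun _ => 0) (t₀ := t₀) continuousAt_const continuousAt_const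
    ((hd hF i).and h1 |>.mono fun t h => by simpa [h.2] using h.1)
    (.of_forall fun t => by simpa using hasDerivAt_const t (0 : ℝ)) (by simp [hF0]) rfl
  exact h2

end PlaneCurve

/-! ### Local diffeomorphisms and shears. -/

section LocalDiffeomorph

lemma SmoothNear.isLocalDiffeomorphAt {E F : Type*} [NormedAddCommGroup E] [NormedSpace ℝ E]
    [CompleteSpace E] [NormedAddCommGroup F] [NormedSpace ℝ F] {f : E → F} {a : E}
    (hf : SmoothNear f a) {e : E ≃L[ℝ] F} (he : HasFDerivAt f (e : E →L[ℝ] F) a) :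
    IsLocalDiffeomorphAt 𝓘(ℝ, E) 𝓘(ℝ, F) ∞ f a := by
  obtain ⟨h, ha, hfa, h1, h2⟩ := hf.exists_openPartialHomeomorph he
  exact ⟨{ h with
      contMDiffOn_toFun := h1.contMDiffOn
      contMDiffOn_invFun := h2.contMDiffOn }, ha, fun x _ => (hfa x).symm⟩

variable {m : ℕ}

local notation "𝔼" => EuclideanSpace ℝ (Fin m)

/-- The shear `z ↦ z + H(z_i) e_j`. -/
lemma isLocalDiffeomorphAt_shear {H : ℝ → ℝ} (hH : SmoothNear H 0) {i j : Fin m} (hij : i ≠ j) :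
    IsLocalDiffeomorphAt 𝓘(ℝ, 𝔼) 𝓘(ℝ, 𝔼) ∞
      (fun z : 𝔼 => z + H (z i) • EuclideanSpace.single j (1 : ℝ)) 0 := by
  have hp : SmoothNear (fun z : 𝔼 => z i) 0 :=
    (SmoothNear.of_contDiff contDiff_id).euclideanSpace_apply i
  have hsm : SmoothNear (fun z : 𝔼 => z + H (z i) • EuclideanSpace.single j (1 : ℝ)) 0 :=
    (SmoothNear.of_contDiff contDiff_id).add
      ((SmoothNear.comp (0 : 𝔼) (g := H) (by simpa using hH) hp).smul
        (SmoothNear.of_contDiff contDiff_const))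
  set c := deriv H 0
  have hsingle : ∀ d : ℝ, (d • EuclideanSpace.single j (1 : ℝ) : 𝔼) i = 0 := fun d => by
    simp [hij]
  let e : 𝔼 ≃L[ℝ] 𝔼 := ContinuousLinearEquiv.equivOfInverse
    (ContinuousLinearMap.id ℝ 𝔼 +
      (c • EuclideanSpace.proj (𝕜 := ℝ) i).smulRight (EuclideanSpace.single j (1 : ℝ)))
    (ContinuousLinearMap.id ℝ 𝔼 -
      (c • EuclideanSpace.proj (𝕜 := ℝ) i).smulRight (EuclideanSpace.single j (1 : ℝ)))
    (fun z => by simp [hij]) (fun z => by simp [hij])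
  refine hsm.isLocalDiffeomorphAt (e := e) ?_
  have h1 : HasFDerivAt (fun z : 𝔼 => z i) (EuclideanSpace.proj (𝕜 := ℝ) i : 𝔼 →L[ℝ] ℝ) 0 :=
    (EuclideanSpace.proj (𝕜 := ℝ) i : 𝔼 →L[ℝ] ℝ).hasFDerivAt
  have h2 : HasDerivAt H c ((0 : 𝔼) i) := hH.differentiableAt.hasDerivAt
  exact (hasFDerivAt_id _).add ((h2.comp_hasFDerivAt (0 : 𝔼) h1).smul_const _)

end LocalDiffeomorph

end

noncomputable section

/-! ### The ruled surface of tangent lines in Euclidean space. -/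

section EuclideanRuledSurface

variable {m : ℕ}

local notation "𝔼" => EuclideanSpace ℝ (Fin m)

/-- Components other than the first two vanish near `t₀`, for the curve and hence for its velocity.
The planar normal form handles the other two, and the correction `H` is absorbed by a shear of the
target. -/
lemma exists_foldModel_eq_of_adapted (hm : 2 ≤ m) {F : ℝ → 𝔼} {t₀ : ℝ} (hF : SmoothNear F t₀)
    (hF0 : F t₀ = 0) (hF1 : deriv F t₀ = EuclideanSpace.single ⟨0, by omega⟩ 1)
    (hF2 : deriv (deriv F) t₀ = EuclideanSpace.single ⟨1, by omega⟩ 1)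
    (hF3 : ∀ᶠ t in 𝓝 t₀, ∃ a b : ℝ,
      deriv (deriv (deriv F)) t = a • deriv F t + b • deriv (deriv F) t)
    {r : ℝ × ℝ → ℝ} (hr : SmoothNear r (t₀, 0)) (hr0 : ∀ᶠ t in 𝓝 t₀, r (t, 0) = 0)
    (hr1 : HasDerivAt (fun s => r (t₀, s)) 1 0) :
    ∃ (σ : ℝ × ℝ → ℝ × ℝ) (τ : 𝔼 → 𝔼),
      IsLocalDiffeomorphAt 𝓘(ℝ, ℝ × ℝ) 𝓘(ℝ, ℝ × ℝ) ∞ σ (t₀, 0) ∧ σ (t₀, 0) = 0 ∧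
      IsLocalDiffeomorphAt 𝓘(ℝ, 𝔼) 𝓘(ℝ, 𝔼) ∞ τ 0 ∧ τ 0 = 0 ∧
      ∀ᶠ z : ℝ × ℝ in 𝓝 (t₀, 0), τ (F z.1 + r z • deriv F z.1) = foldModel m (σ z) := by
  set i₀ : Fin m := ⟨0, by omega⟩ with hi₀
  set i₁ : Fin m := ⟨1, by omega⟩ with hi₁
  have h01 : i₀ ≠ i₁ := by simp [hi₀, hi₁]
  have hd : ∀ {G : ℝ → 𝔼}, SmoothNear G t₀ → ∀ i, ∀ᶠ t in 𝓝 t₀,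
      deriv (fun t => G t i) t = deriv G t i := fun hG i =>
    hG.mono fun t ht => ((ht.differentiableAt (by simp)).hasDerivAt.euclideanSpace_apply i).deriv
  have hdd : ∀ i, deriv (deriv fun t => F t i) t₀ = deriv (deriv F) t₀ i := fun i =>
    (Filter.EventuallyEq.deriv_eq (hd hF i)).trans (hd hF.deriv i).self_of_nhds
  obtain ⟨H, a, b, hH, hH0, ha, hb, ha0, hb0, ⟨e, he⟩, hev⟩ := exists_fold_normal_form
    (hF.euclideanSpace_apply i₀) (hF.euclideanSpace_apply i₁) hr (by simp [hF0]) (by simp [hF0])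
    (by rw [(hd hF i₀).self_of_nhds, hF1]; simp)
    (by rw [(hd hF i₁).self_of_nhds, hF1]; simp [h01.symm])
    (by rw [hdd, hF2]; simp) hr0 hr1
  refine ⟨fun z => (a z, b z), fun z => z + H (z i₀) • EuclideanSpace.single i₁ (1 : ℝ),
    (ha.prodMk hb).isLocalDiffeomorphAt he, by simp [ha0, hb0],
    isLocalDiffeomorphAt_shear hH h01, by simp [hH0], ?_⟩
  have hvan : ∀ᶠ t in 𝓝 t₀, ∀ i, i ≠ i₀ → i ≠ i₁ → F t i = 0 := by
    refine eventually_all.2 fun i => ?_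
    by_cases h0 : i = i₀
    · exact .of_forall fun _ h => absurd h0 h
    by_cases h1 : i = i₁
    · exact .of_forall fun _ _ h => absurd h1 h
    filter_upwards [eventually_apply_eq_zero hF hF0 hF1 hF2 h01 hF3 h0 h1] with t ht _ _ using ht
  have hfst : Tendsto (Prod.fst : ℝ × ℝ → ℝ) (𝓝 (t₀, 0)) (𝓝 t₀) := continuous_fst.continuousAt
  filter_upwards [hev, hfst.eventually hvan.eventually_nhds,
    hfst.eventually (eventually_all.2 fun i => hd hF i)] with z h1 h2 h3
  rw [h3, h3] at h1
  ext i
  by_cases h0 : i = i₀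
  · subst h0
    simp [foldModel, h01, h1.1]
    simp [hi₀]
  by_cases h1' : i = i₁
  · subst h1'
    have : ((i₁ : Fin m) : ℕ) = 1 := rfl
    simp [foldModel, this]
    linarith [h1.2]
  · have hz : (fun t => F t i) =ᶠ[𝓝 z.1] fun _ => 0 := h2.mono fun t ht => ht i h0 h1'
    have hd0 : deriv F z.1 i = 0 := by rw [← h3, hz.deriv_eq, deriv_const]
    have e0 : (i : ℕ) ≠ 0 := fun h => h0 (Fin.ext h)
    have e1 : (i : ℕ) ≠ 1 := fun h => h1' (Fin.ext h)
    simp [foldModel, e0, e1, h1', hd0, h2.self_of_nhds i h0 h1']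

/-- The tangent surface of a regular plane curve of nonvanishing curvature is a fold. -/
lemma exists_foldModel_eq (hm : 2 ≤ m) {g : ℝ → 𝔼} {t₀ : ℝ} (hg : SmoothNear g t₀)
    (hind : LinearIndependent ℝ ![deriv g t₀, deriv (deriv g) t₀])
    (hdep : ∀ᶠ t in 𝓝 t₀, ∃ a b : ℝ,
      deriv (deriv (deriv g)) t = a • deriv g t + b • deriv (deriv g) t)
    {r : ℝ × ℝ → ℝ} (hr : SmoothNear r (t₀, 0)) (hr0 : ∀ᶠ t in 𝓝 t₀, r (t, 0) = 0)
    (hr1 : HasDerivAt (fun s => r (t₀, s)) 1 0) :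
    ∃ (σ : ℝ × ℝ → ℝ × ℝ) (τ : 𝔼 → 𝔼),
      IsLocalDiffeomorphAt 𝓘(ℝ, ℝ × ℝ) 𝓘(ℝ, ℝ × ℝ) ∞ σ (t₀, 0) ∧ σ (t₀, 0) = 0 ∧
      IsLocalDiffeomorphAt 𝓘(ℝ, 𝔼) 𝓘(ℝ, 𝔼) ∞ τ (g t₀) ∧ τ (g t₀) = 0 ∧
      ∀ᶠ z : ℝ × ℝ in 𝓝 (t₀, 0), τ (g z.1 + r z • deriv g z.1) = foldModel m (σ z) := by
  have hstd : LinearIndependent ℝ ![(EuclideanSpace.single ⟨0, by omega⟩ 1 : 𝔼),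
      EuclideanSpace.single ⟨1, by omega⟩ 1] := by
    refine LinearIndependent.pair_iff.2 fun p q h => ⟨?_, ?_⟩
    · simpa using congrArg (fun v : 𝔼 => v ⟨0, by omega⟩) h
    · simpa using congrArg (fun v : 𝔼 => v ⟨1, by omega⟩) h
  -- An affine change of coordinates moves `g`, `g'`, `g''` at `t₀` to the adapted position; the
  -- relation `hdep` is preserved by linear maps.
  obtain ⟨Λ', hΛ'⟩ := exists_linearEquiv_apply_eq hind hstd
  set Λ : 𝔼 ≃L[ℝ] 𝔼 := Λ'.toContinuousLinearEquiv
  have hΛ0 : Λ (deriv g t₀) = EuclideanSpace.single ⟨0, by omega⟩ 1 := hΛ' 0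
  have hΛ1 : Λ (deriv (deriv g) t₀) = EuclideanSpace.single ⟨1, by omega⟩ 1 := hΛ' 1
  have hΛ : ∀ {G : ℝ → 𝔼}, SmoothNear G t₀ →
      deriv (fun t => Λ (G t)) =ᶠ[𝓝 t₀] fun t => Λ (deriv G t) := fun hG =>
    hG.mono fun t ht => ((Λ : 𝔼 →L[ℝ] 𝔼).hasFDerivAt.comp_hasDerivAt t
      (ht.differentiableAt (by simp)).hasDerivAt).deriv
  have hG : SmoothNear (fun t => g t - g t₀) t₀ := hg.sub (SmoothNear.of_contDiff contDiff_const)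
  have hΛs : ∀ a, SmoothNear (fun z => Λ (z - g t₀)) a := fun a =>
    SmoothNear.of_contDiff ((Λ : 𝔼 →L[ℝ] 𝔼).contDiff.comp (contDiff_id.sub contDiff_const))
  have h1 : deriv (fun t => Λ (g t - g t₀)) =ᶠ[𝓝 t₀] fun t => Λ (deriv g t) :=
    (hΛ hG).trans (.of_forall fun t => by simp)
  have h2 := h1.deriv.trans (hΛ hg.deriv)
  have h3 := h2.deriv.trans (hΛ hg.deriv.deriv)
  obtain ⟨σ, τ, hσ, hσ0, hτ, hτ0, hev⟩ := exists_foldModel_eq_of_adapted hm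
    (F := fun t => Λ (g t - g t₀)) (SmoothNear.comp t₀ (g := fun z => Λ (z - g t₀)) (hΛs _) hg)
    (by simp) (h1.eq_of_nhds.trans hΛ0) (h2.eq_of_nhds.trans hΛ1)
    (by
      filter_upwards [h1, h2, h3, hdep] with t e1 e2 e3 ⟨a, b, hab⟩
      exact ⟨a, b, by rw [e1, e2, e3, hab, map_add, map_smul, map_smul]⟩) hr hr0 hr1
  have hA : IsLocalDiffeomorphAt 𝓘(ℝ, 𝔼) 𝓘(ℝ, 𝔼) ∞ (fun z => Λ (z - g t₀)) (g t₀) :=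
    (hΛs _).isLocalDiffeomorphAt (e := Λ)
      ((Λ : 𝔼 →L[ℝ] 𝔼).hasFDerivAt.comp _ ((hasFDerivAt_id _).sub_const _))
  refine ⟨σ, τ ∘ fun z => Λ (z - g t₀), hσ, hσ0, hA.comp _ _ (by simpa using hτ), by simp [hτ0], ?_⟩
  have hfst : Tendsto (Prod.fst : ℝ × ℝ → ℝ) (𝓝 (t₀, 0)) (𝓝 t₀) := continuous_fst.continuousAt
  filter_upwards [hev, hfst.eventually h1] with z e1 e2
  rw [← e1, e2, Function.comp_apply, ← map_smul, ← map_add]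
  congr 2
  abel

end EuclideanRuledSurface

/-! ### The tangent surface in projectively flat coordinates. -/

section TangentSurface

variable {m : ℕ} {M : Type*} [TopologicalSpace M] [ChartedSpace (EuclideanSpace ℝ (Fin m)) M]

local notation "𝔼" => EuclideanSpace ℝ (Fin m)

namespace PartialDiffeomorph

lemma totalSpace_ext (Ψ : PartialDiffeomorph (𝓡 m) 𝓘(ℝ, 𝔼) M 𝔼 ∞) {p p' : TangentBundle (𝓡 m) M}
    (hp : p.1 ∈ Ψ.source) (h : p.1 = p'.1) (hv : Ψ.dcoord p.1 p.2 = Ψ.dcoord p'.1 p'.2) :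
    p = p' := by
  obtain ⟨x, v⟩ := p
  obtain ⟨x', v'⟩ := p'
  obtain rfl : x = x' := h
  obtain rfl : v = v' := Ψ.dcoord_injective hp hv
  rfl

variable [IsManifold (𝓡 m) ∞ M]

/-- In coordinates in which geodesics are straight lines, the tangent surface of a curve is ruled
by its tangent lines. -/
lemma exists_tangentSurface_eq [T2Space M] (Ψ : PartialDiffeomorph (𝓡 m) 𝓘(ℝ, 𝔼) M 𝔼 ∞)
    (cov : CovariantDerivative (𝓡 m) 𝔼 (TangentSpace (𝓡 m) : M → Type _))
    (hG : ∀ y ∈ Ψ.target, ∀ i j, ContDiffAt ℝ ∞ (Ψ.christoffel cov i j) y)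
    (hpar : ∀ y ∈ Ψ.target, ∀ v, ∃ l : ℝ, christoffelForm (Ψ.christoffel cov) y v v = l • v)
    {γ : ℝ → M} {t₀ : ℝ} (hs : γ t₀ ∈ Ψ.source)
    (hγ : ∀ᶠ t in 𝓝 t₀, ContMDiffAt 𝓘(ℝ, ℝ) (𝓡 m) ∞ γ t)
    (hne : deriv (fun t => Ψ (γ t)) t₀ ≠ 0) :
    ∃ r : ℝ × ℝ → ℝ, SmoothNear r (t₀, 0) ∧ (∀ᶠ t in 𝓝 t₀, r (t, 0) = 0) ∧
      HasDerivAt (fun s => r (t₀, s)) 1 0 ∧ ∀ᶠ z : ℝ × ℝ in 𝓝 (t₀, 0),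
        Ψ (γ z.1) + r z • deriv (fun t => Ψ (γ t)) z.1 ∈ Ψ.target ∧
        tangentSurface cov γ z = Ψ.symm (Ψ (γ z.1) + r z • deriv (fun t => Ψ (γ t)) z.1) := by
  obtain ⟨g, hg⟩ : ∃ g : ℝ → 𝔼, g = fun t => Ψ (γ t) := ⟨_, rfl⟩
  have hgs : SmoothNear g t₀ := hg ▸ Ψ.smoothNear_comp hs hγ
  have hvel : ∀ᶠ t in 𝓝 t₀, Ψ.dcoord (γ t) (curveVelocity γ t) = deriv g t :=
    hg ▸ Ψ.eventually_dcoord_curveVelocity hs hγ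
  have hgγ : ∀ t, Ψ (γ t) = g t := fun t => by rw [hg]
  rw [← hg] at hne ⊢
  simp only [hgγ]
  have hfst : ∀ s : ℝ, Tendsto (Prod.fst : ℝ × ℝ → ℝ) (𝓝 (t₀, s)) (𝓝 t₀) :=
    fun s => continuous_fst.continuousAt
  have hg₁ : SmoothNear (fun z : ℝ × ℝ => g z.1) (t₀, 0) :=
    SmoothNear.comp (t₀, (0 : ℝ)) (g := g) hgs (SmoothNear.of_contDiff contDiff_fst)
  have hg₂ : SmoothNear (fun z : ℝ × ℝ => deriv g z.1) (t₀, 0) :=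
    SmoothNear.comp (t₀, (0 : ℝ)) (g := deriv g) hgs.deriv (SmoothNear.of_contDiff contDiff_fst)
  have hline : ∀ {ρ : ℝ × ℝ → ℝ}, SmoothNear ρ (t₀, 0) → ρ (t₀, 0) = 0 →
      SmoothNear (fun z => g z.1 + ρ z • deriv g z.1) (t₀, 0) ∧
      ∀ᶠ z in 𝓝 (t₀, 0), g z.1 + ρ z • deriv g z.1 ∈ Ψ.target := by
    intro ρ hρ hρ0
    have h := hg₁.add (hρ.smul hg₂)
    refine ⟨h, h.contDiffAt.continuousAt.eventually (Ψ.open_target.mem_nhds ?_)⟩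
    simp only [hρ0, zero_smul, add_zero, ← hgγ]
    exact Ψ.map_source hs
  have hne' : ∀ᶠ t in 𝓝 t₀, deriv g t ≠ 0 := hgs.deriv.contDiffAt.continuousAt.eventually_ne hne
  -- The factor in `Γ(g', g') = l g'`, extracted by inner products so that it is visibly smooth in
  -- `(t, ρ)`.
  set κ : ℝ × ℝ → ℝ := fun z => inner ℝ (christoffelForm (Ψ.christoffel cov)
    (g z.1 + z.2 • deriv g z.1) (deriv g z.1) (deriv g z.1)) (deriv g z.1) /
      inner ℝ (deriv g z.1) (deriv g z.1) with hκ
  have hκs : SmoothNear κ (t₀, 0) := by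
    obtain ⟨h1, h2⟩ := hline (ρ := Prod.snd) (SmoothNear.of_contDiff contDiff_snd) rfl
    filter_upwards [h1, h2, hg₂, (hfst 0).eventually hne'] with z k1 k2 k3 k4
    have k5 := contDiffAt_christoffelForm (y := fun z : ℝ × ℝ => g z.1 + z.2 • deriv g z.1)
      (hG _ k2) k1 k3 k3
    exact (k5.inner ℝ k3).div (k3.inner ℝ k3) (inner_self_ne_zero.2 k4)
  have hκe : ∀ {t ρ : ℝ}, deriv g t ≠ 0 → g t + ρ • deriv g t ∈ Ψ.target →
      christoffelForm (Ψ.christoffel cov) (g t + ρ • deriv g t) (deriv g t) (deriv g t) =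
        κ (t, ρ) • deriv g t := by
    intro t ρ h1 h2
    obtain ⟨l, hl⟩ := hpar _ h2 (deriv g t)
    have : κ (t, ρ) = l := by
      simp only [hκ]
      rw [hl, real_inner_smul_left, mul_div_assoc, div_self (inner_self_ne_zero.2 h1), mul_one]
    rw [hl, this]
  -- Substituting `g + r g'` into the geodesic equation leaves exactly `r'' = -κ(t, r) (r')²`.
  obtain ⟨r, r₁, hr, hr0, hrd⟩ := hκs.exists_affine_reparametrization
  have hr00 := hr0.self_of_nhds
  have hrd0 : HasDerivAt (fun s => r (t₀, s)) 1 0 := by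
    have := hrd.self_of_nhds.1
    rwa [hr00.2] at this
  refine ⟨r, hr, hr0.mono fun t h => h.1, hrd0, ?_⟩
  obtain ⟨hys, hyt⟩ := hline hr hr00.1
  -- A product neighbourhood provides an interval of `s` around `0`, uniform in `t`, on which each
  -- ruling is a geodesic.
  obtain ⟨A, hA, B, hB, hAB⟩ := Filter.eventually_prod_iff.1
    (nhds_prod_eq (x := t₀) (y := (0 : ℝ)) ▸ (hys.and (hyt.and hrd)))
  obtain ⟨δ, hδ, hδB⟩ := Metric.eventually_nhds_iff_ball.1 hB
  have hsrc : ∀ᶠ t in 𝓝 t₀, γ t ∈ Ψ.source :=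
    hγ.self_of_nhds.continuousAt.eventually (Ψ.open_source.mem_nhds hs)
  have hball : ∀ᶠ s in 𝓝 (0 : ℝ), s ∈ Metric.ball (0 : ℝ) δ := Metric.ball_mem_nhds 0 hδ
  have hall := (((hA.and hr0).and (hγ.and hsrc)).and (hvel.and hne')).prod_mk hball
  rw [← nhds_prod_eq] at hall
  filter_upwards [hall] with z hz
  obtain ⟨t, s⟩ := z
  obtain ⟨⟨⟨⟨hAt, hrt, hr₁t⟩, hγt, hsrct⟩, hvt, hnet⟩, hst⟩ := hz
  simp only at hAt hrt hr₁t hγt hsrct hvt hnet hst ⊢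
  have hprop : ∀ s ∈ Metric.ball (0 : ℝ) δ, _ := fun s hs => hAB hAt (hδB s hs)
  refine ⟨(hprop s hst).2.1, ?_⟩
  have h0 : (0 : ℝ) ∈ Metric.ball (0 : ℝ) δ := Metric.mem_ball_self hδ
  have hd1 : ∀ s ∈ Metric.ball (0 : ℝ) δ,
      HasDerivAt (fun s => g t + r (t, s) • deriv g t) (r₁ (t, s) • deriv g t) s := fun s hs =>
    ((hprop s hs).2.2.1.smul_const (deriv g t)).const_add (g t)
  have hgeo : IsGeodesicCurveOn cov (fun s => Ψ.symm (g t + r (t, s) • deriv g t))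
      (Metric.ball (0 : ℝ) δ) := by
    refine Ψ.isGeodesicCurveOn_symm_comp cov Metric.isOpen_ball (fun s hs => ?_)
      (fun s hs => (hprop s hs).2.1) (y₁ := fun s => r₁ (t, s) • deriv g t) hd1 fun s hs => ?_
    · exact ((hprop s hs).1.comp s (contDiffAt_const.prodMk contDiffAt_id)).contDiffWithinAt
    · rw [christoffelForm_smul_smul, hκe hnet (hprop s hs).2.1, smul_smul, ← neg_smul]
      have hsq : -(r₁ (t, s) * r₁ (t, s) * κ (t, r (t, s))) =
          -(κ (t, r (t, s)) * r₁ (t, s) ^ 2) := by ring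
      rw [hsq]
      exact (hprop s hs).2.2.2.smul_const (deriv g t)
  have hc0 : Ψ.symm (g t + r (t, 0) • deriv g t) = γ t := by
    rw [hrt, zero_smul, add_zero, ← hgγ]
    exact Ψ.left_inv hsrct
  refine Ψ.geodesicMap_eq cov hG (c := fun s => Ψ.symm (g t + r (t, s) • deriv g t))
    (J := Metric.ball 0 δ) ⟨Metric.isOpen_ball, (convex_ball 0 δ).ordConnected, h0, hgeo, ?_⟩
    (fun s hs => Ψ.map_target (hprop s hs).2.1) hst
  refine Ψ.totalSpace_ext (Ψ.map_target (hprop 0 h0).2.1) hc0 ?_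
  refine (Ψ.dcoord_curveVelocity (Ψ.map_target (hprop 0 h0).2.1)
    (((hgeo.smooth 0 h0).contMDiffAt (Metric.ball_mem_nhds 0 hδ)).mdifferentiableAt
      (by simp))).trans ?_
  have hd : HasDerivAt (fun s => Ψ (Ψ.symm (g t + r (t, s) • deriv g t))) (deriv g t) 0 := by
    have := hd1 0 h0
    rw [hr₁t, one_smul] at this
    refine this.congr_of_eventuallyEq ?_
    filter_upwards [Metric.ball_mem_nhds (0 : ℝ) hδ] with s hs
    exact Ψ.right_inv (hprop s hs).2.1
  rw [hd.deriv]
  exact hvt.symm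

end PartialDiffeomorph

end TangentSurface

end

noncomputable section

/-! ### Torsionless curves in projectively flat coordinates. -/

section Torsionless

variable {m : ℕ} {M : Type*} [TopologicalSpace M] [ChartedSpace (EuclideanSpace ℝ (Fin m)) M]

local notation "𝔼" => EuclideanSpace ℝ (Fin m)

variable [IsManifold (𝓡 m) ∞ M]

namespace PartialDiffeomorph

/-- A partial diffeomorphism realising projective flatness. -/
lemma exists_of_isProjectivelyFlatAround
    {cov : CovariantDerivative (𝓡 m) 𝔼 (TangentSpace (𝓡 m) : M → Type _)} {q : M}
    (hflat : IsProjectivelyFlatAround cov q) :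
    ∃ Ψ : PartialDiffeomorph (𝓡 m) 𝓘(ℝ, 𝔼) M 𝔼 ∞, q ∈ Ψ.source ∧
      ∀ (c : ℝ → M) (J : Set ℝ), IsOpen J → J.OrdConnected → IsGeodesicCurveOn cov c J →
        MapsTo c J Ψ.source → ∃ a b : 𝔼, ∀ s ∈ J, ∃ r : ℝ, Ψ (c s) = a + r • b := by
  obtain ⟨Φ, ⟨Ψ₀, hq, heq⟩, U, hU, h⟩ := hflat
  obtain ⟨Ψ, hsrc, hΨ⟩ := Ψ₀.exists_restrict (isOpen_interior (s := U))
  refine ⟨Ψ, by rw [hsrc]; exact ⟨hq, mem_interior_iff_mem_nhds.2 hU⟩, fun c J hJ hJ' hc hm => ?_⟩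
  rw [hsrc] at hm
  obtain ⟨a, b, hab⟩ := h c J hJ hJ' hc fun s hs => interior_subset (hm hs).2
  refine ⟨a, b, fun s hs => ?_⟩
  obtain ⟨r, hr⟩ := hab s hs
  exact ⟨r, by rw [hΨ, ← heq (hm hs).1, hr]⟩

/-- In coordinates in which geodesics are straight lines, a torsionless curve has linearly
independent first and second derivatives, and its third derivative is in their span. -/
lemma linearIndependent_deriv_of_torsionless (Ψ : PartialDiffeomorph (𝓡 m) 𝓘(ℝ, 𝔼) M 𝔼 ∞)
    (cov : CovariantDerivative (𝓡 m) 𝔼 (TangentSpace (𝓡 m) : M → Type _))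
    (hG : ∀ y ∈ Ψ.target, ∀ i j, ContDiffAt ℝ ∞ (Ψ.christoffel cov i j) y)
    (hsymm : ∀ y ∈ Ψ.target, ∀ i j, Ψ.christoffel cov i j y = Ψ.christoffel cov j i y)
    (hpar : ∀ y ∈ Ψ.target, ∀ v, ∃ l : ℝ, christoffelForm (Ψ.christoffel cov) y v v = l • v)
    {γ : ℝ → M} {t : ℝ} (hs : γ t ∈ Ψ.source)
    (hγ : ∀ᶠ t in 𝓝 t, ContMDiffAt 𝓘(ℝ, ℝ) (𝓡 m) ∞ γ t)
    (hind : LinearIndependent ℝ ![iterCovDeriv cov γ 0 t, iterCovDeriv cov γ 1 t])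
    (hdep : ¬ LinearIndependent ℝ
      ![iterCovDeriv cov γ 0 t, iterCovDeriv cov γ 1 t, iterCovDeriv cov γ 2 t]) :
    LinearIndependent ℝ ![deriv (fun t => Ψ (γ t)) t, deriv (deriv fun t => Ψ (γ t)) t] ∧
    ∃ a b : ℝ, deriv (deriv (deriv fun t => Ψ (γ t))) t =
      a • deriv (fun t => Ψ (γ t)) t + b • deriv (deriv fun t => Ψ (γ t)) t := by
  obtain ⟨g, hg⟩ : ∃ g : ℝ → 𝔼, g = fun t => Ψ (γ t) := ⟨_, rfl⟩
  have hgs : SmoothNear g t := hg ▸ Ψ.smoothNear_comp hs hγ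
  have hvel : ∀ᶠ t in 𝓝 t, Ψ.dcoord (γ t) (curveVelocity γ t) = deriv g t :=
    hg ▸ Ψ.eventually_dcoord_curveVelocity hs hγ
  have hsrc : ∀ᶠ t in 𝓝 t, γ t ∈ Ψ.source :=
    hγ.self_of_nhds.continuousAt.eventually (Ψ.open_source.mem_nhds hs)
  have hacc : ∀ᶠ t in 𝓝 t, Ψ.dcoord (γ t) (iterCovDeriv cov γ 1 t) = deriv (deriv g) t +
      christoffelForm (Ψ.christoffel cov) (g t) (deriv g t) (deriv g t) := by
    filter_upwards [hγ.eventually_nhds, hsrc] with t h1 h2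
    rw [hg]
    exact Ψ.dcoord_covDerivAlong_curveVelocity cov h2 h1
  rw [← hg]
  have hgt : ∀ᶠ t in 𝓝 t, g t ∈ Ψ.target := hsrc.mono fun t h => by
    rw [hg]; exact Ψ.map_source h
  have hne : deriv g t ≠ 0 := by
    rw [← hvel.self_of_nhds]
    intro h
    exact hind.ne_zero 0 (Ψ.dcoord_injective hs (h.trans (map_zero _).symm))
  have hne' : ∀ᶠ t in 𝓝 t, deriv g t ≠ 0 := hgs.deriv.contDiffAt.continuousAt.eventually_ne hne
  -- The quotient makes the factor in `Γ(g', g') = κ g'` differentiable, as needed when `∇²γ = g'' +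
  -- κ g'` is differentiated again.
  set κ : ℝ → ℝ := fun t => inner ℝ (christoffelForm (Ψ.christoffel cov) (g t) (deriv g t)
    (deriv g t)) (deriv g t) / inner ℝ (deriv g t) (deriv g t) with hκ
  have hκd : DifferentiableAt ℝ κ t := by
    have h2 := contDiffAt_christoffelForm (hG _ hgt.self_of_nhds) hgs.contDiffAt
      hgs.deriv.contDiffAt hgs.deriv.contDiffAt
    have h3 := hgs.deriv.contDiffAt
    exact ((h2.inner ℝ h3).div (h3.inner ℝ h3) (inner_self_ne_zero.2 hne)).differentiableAt
      (by simp)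
  have hacc' : ∀ᶠ t in 𝓝 t, Ψ.dcoord (γ t) (iterCovDeriv cov γ 1 t) =
      deriv (deriv g) t + κ t • deriv g t := by
    filter_upwards [hacc, hgt, hne'] with t h1 h2 h3
    obtain ⟨l, hl⟩ := hpar _ h2 (deriv g t)
    have : κ t = l := by
      simp only [hκ]
      rw [hl, real_inner_smul_left, mul_div_assoc, div_self (inner_self_ne_zero.2 h3), mul_one]
    rw [h1, hl, this]
  have hd1 := hgs.deriv.differentiableAt
  have hd2 := hgs.deriv.deriv.differentiableAt
  have hjerk := Ψ.dcoord_covDerivAlong cov hs (hγ.self_of_nhds.mdifferentiableAt (by simp))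
    (iterCovDeriv cov γ 1) (s := fun t => deriv (deriv g) t + κ t • deriv g t)
    (hd2.add (hκd.smul hd1)) hacc'
  have hderiv : deriv (fun t => deriv (deriv g) t + κ t • deriv g t) t =
      deriv (deriv (deriv g)) t + (κ t • deriv (deriv g) t + deriv κ t • deriv g t) :=
    (hd2.hasDerivAt.add (hκd.hasDerivAt.smul hd1.hasDerivAt)).deriv
  rw [hderiv, hvel.self_of_nhds] at hjerk
  -- By polarization the Christoffel term of `∇³γ` stays in the span of `g'` and `g''`.
  obtain ⟨p, q, hpq⟩ := exists_christoffelForm_eq_add (hsymm _ (Ψ.map_source hs))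
    (hpar _ (Ψ.map_source hs)) (deriv g t) (deriv (deriv g) t + κ t • deriv g t)
  obtain ⟨a, b, hab⟩ := exists_eq_add_of_dependent hind hdep
  have h3 : Ψ.dcoord (γ t) (iterCovDeriv cov γ 2 t) =
      a • deriv g t + b • (deriv (deriv g) t + κ t • deriv g t) := by
    rw [hab, map_add, map_smul, map_smul, hacc'.self_of_nhds]
    congr 2
    exact hvel.self_of_nhds
  have h4 := hjerk.symm.trans h3
  rw [hpq] at h4
  constructor
  · refine LinearIndependent.pair_iff.2 fun c d h => ?_
    have h5 : (c - d * κ t) • iterCovDeriv cov γ 0 t + d • iterCovDeriv cov γ 1 t = 0 := by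
      apply Ψ.dcoord_injective hs
      rw [map_add, map_smul, map_smul, hacc'.self_of_nhds, map_zero]
      refine Eq.trans ?_ h
      have : Ψ.dcoord (γ t) (iterCovDeriv cov γ 0 t) = deriv g t := hvel.self_of_nhds
      rw [this]
      module
    obtain ⟨h6, h7⟩ := LinearIndependent.pair_iff.1 hind _ _ h5
    rw [h7, zero_mul, sub_zero] at h6
    exact ⟨h6, h7⟩
  · refine ⟨a + b * κ t - deriv κ t - p - q * κ t, b - κ t - q, ?_⟩
    rw [← sub_eq_zero] at h4 ⊢
    rw [← h4]
    module

end PartialDiffeomorph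

end Torsionless

end

/-! ### The main theorem. -/

theorem proposition12p3 {m : ℕ} (hm : 3 ≤ m)
    {M : Type*} [TopologicalSpace M] [T2Space M]
    [ChartedSpace (EuclideanSpace ℝ (Fin m)) M] [IsManifold (𝓡 m) ∞ M]
    (cov : CovariantDerivative (𝓡 m) (EuclideanSpace ℝ (Fin m)) (TangentSpace (𝓡 m) : M → Type _))
    [CovariantDerivative.ContMDiffCovariantDerivative cov ∞]
    (htorsion : cov.torsion = 0)
    (q : M) (hflat : IsProjectivelyFlatAround cov q)
    (γ : ℝ → M) (J : Set ℝ) (hJ : IsOpen J) (t₀ : ℝ) (ht₀ : t₀ ∈ J) (hq : γ t₀ = q)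
    (hγ : IsTorsionlessOn cov γ J) :
    tangentSurface cov γ (t₀, 0) = q ∧
    IsFoldAt m (tangentSurface cov γ) (t₀, 0) ∧
    IsGenericallyTwoToOneAt (tangentSurface cov γ) (t₀, 0) := by
  obtain ⟨Ψ, hqs, hlines⟩ := PartialDiffeomorph.exists_of_isProjectivelyFlatAround hflat
  have hG : ∀ y ∈ Ψ.target, ∀ i j, ContDiffAt ℝ ∞ (Ψ.christoffel cov i j) y := by
    intro y hy i j
    have h := Ψ.contDiffAt_christoffel cov (Ψ.map_target hy) i j
    rwa [Ψ.right_inv hy] at h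
  have hpar : ∀ y ∈ Ψ.target, ∀ v, ∃ l : ℝ, christoffelForm (Ψ.christoffel cov) y v v = l • v :=
    fun y hy v => Ψ.exists_christoffelForm_self_eq_smul cov hG hlines hy v
  subst hq
  have hsmooth : ∀ t ∈ J, ∀ᶠ t in 𝓝 t, ContMDiffAt 𝓘(ℝ, ℝ) (𝓡 m) ∞ γ t := by
    intro t ht
    filter_upwards [hJ.mem_nhds ht] with τ hτ
    exact (hγ.smooth τ hτ).contMDiffAt (hJ.mem_nhds hτ)
  have hev := hsmooth t₀ ht₀
  have htl : ∀ t ∈ J, γ t ∈ Ψ.source → _ := fun t ht hs =>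
    Ψ.linearIndependent_deriv_of_torsionless cov hG
      (fun y hy i j => Ψ.christoffel_comm cov htorsion i j hy) hpar hs (hsmooth t ht)
      (hγ.indep t ht) (hγ.dep t ht)
  have hgs := Ψ.smoothNear_comp hqs hev
  have hind := (htl t₀ ht₀ hqs).1
  obtain ⟨r, hr, hr0, hr1, hsurf⟩ := Ψ.exists_tangentSurface_eq cov hG hpar hqs hev
    (hind.ne_zero 0)
  obtain ⟨σ, τ, hσ, hσ0, hτ, hτ0, hfold⟩ := exists_foldModel_eq (by omega) hgs hind (by
    filter_upwards [hJ.mem_nhds ht₀,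
      hev.self_of_nhds.continuousAt.eventually (Ψ.open_source.mem_nhds hqs)] with t h1 h2
    exact (htl t h1 h2).2) hr hr0 hr1
  have hbase : tangentSurface cov γ (t₀, 0) = γ t₀ := by
    rw [hsurf.self_of_nhds.2, hr0.self_of_nhds, zero_smul, add_zero]
    exact Ψ.left_inv hqs
  have hF : IsFoldAt m (tangentSurface cov γ) (t₀, 0) := by
    -- Near `(t₀, 0)` the surface is `Ψ.symm` of the Euclidean ruled surface, so `Ψ` followed by the
    -- Euclidean `τ` straightens it.
    refine ⟨?_, σ, τ ∘ Ψ, hσ, hσ0, ?_, ?_, ?_⟩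
    · have h1 : SmoothNear (fun z : ℝ × ℝ => Ψ (γ z.1) + r z • deriv (fun t => Ψ (γ t)) z.1)
          (t₀, 0) :=
        (SmoothNear.comp (t₀, (0 : ℝ)) (g := fun t => Ψ (γ t)) hgs
          (SmoothNear.of_contDiff contDiff_fst)).add
        (hr.smul (SmoothNear.comp (t₀, (0 : ℝ)) (g := deriv fun t => Ψ (γ t)) hgs.deriv
          (SmoothNear.of_contDiff contDiff_fst)))
      filter_upwards [h1, hsurf.eventually_nhds] with z h2 h3
      have h4 : ContMDiffAt 𝓘(ℝ, ℝ × ℝ) (𝓡 m) ∞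
          (fun z : ℝ × ℝ => Ψ.symm (Ψ (γ z.1) + r z • deriv (fun t => Ψ (γ t)) z.1)) z :=
        ((Ψ.symm.contMDiffOn _ h3.self_of_nhds.1).contMDiffAt
          (Ψ.open_target.mem_nhds h3.self_of_nhds.1)).comp z h2.contMDiffAt
      exact h4.congr_of_eventuallyEq (h3.mono fun z h => h.2)
    · rw [hbase]
      exact IsLocalDiffeomorphAt.comp _ _ ⟨Ψ, hqs, fun _ _ => rfl⟩ hτ
    · rw [hbase]
      exact hτ0
    · filter_upwards [hsurf, hfold] with z h1 h2
      rw [Function.comp_apply, h1.2, ← h2]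
      exact congrArg τ (Ψ.right_inv h1.1)
  exact ⟨hbase, hF, hF.isGenericallyTwoToOneAt (by omega)⟩
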